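/- **Setting.** For a finite set $\Lambda\subset\mathbb Z$ and $n\ge 1$ let $\mathcal X_\Lambda^n$ be the set of configurations $\mathbf x=(x_1,\dots,x_n)\in\Lambda^n$ with $x_1<\dots<x_n$. A *cluster* of $\mathbf x$ is a nonempty set of consecutive sites of $\{x_1,\dots,x_n\}$ that is not neighbouring any other site of $\mathbf x$. Let $k(\mathbf x)$ be the number of clusters of $\mathbf x$, and let $\mathcal C_\Lambda=\{\mathbf x\in\mathcal X_\Lambda^n: k(\mathbf x)=1\}$ be the set of clustered configurations. Put $d(\mathbf x,\mathbf y)=\sum_{j=1}^n|x_j-y_j|$ and, for $\mathbf x,\mathbf y\in\mathcal X^n_\Lambda$, $$\overline d(\mathbf x,\mathbf y)=\min_{\mathbf w,\mathbf v\in\mathcal C_\Lambda}\{d(\mathbf x,\mathbf w)+|w_1-v_1|+d(\mathbf v,\mathbf y)\}.$$ On $\ell^2(\mathcal X_\Lambda^n)$, with orthonormal basis $\{\delta_{\mathbf x}\}$, let $H_\Lambda=-A+2gU+\lambda V$, where $A\delta_{\mathbf x}=\sum_{\mathbf y:\,d(\mathbf x,\mathbf y)=1}\delta_{\mathbf y}$,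 $U\delta_{\mathbf x}=k(\mathbf x)\delta_{\mathbf x}$ and $V\delta_{\mathbf x}=\big(\sum_{j=1}^n\omega(x_j)\big)\delta_{\mathbf x}$. The $\omega(\alpha)$ are independent, identically distributed random variables whose law has a density $\varrho\in L^\infty(\mathbb R)$ with support in $[0,\omega_{\max}]$ for some $\omega_{\max}<\infty$. Write $G_\Lambda(\mathbf x,\mathbf y;E)=\langle\delta_{\mathbf x},(H_\Lambda-E)^{-1}\delta_{\mathbf y}\rangle$ for $E\notin\sigma(H_\Lambda)$. **Theorem.** Let $g>1$ and $\mu_T>0$ be such that $E(g,\mu_T):=4g-12e^{\mu_T}>0$. Let $I\subset[0,E(g,\mu_T))$ be a compact interval, $s\in(0,1)$, $\mu\in(0,\mu_T)$, and let $\varrho$ be as above. Then there exist constants $C_s^{(1)},C_s^{(2)},\lambda_0\in(0,\infty)$ such that for all $n\ge2$, all $\Lambda=[-L,L]\cap\mathbb Z$ with $L\in\mathbb N$, all $\lambda>\lambda_0$ and all $E\in I$: for every $\Lambda'\subseteq\Lambda$ one has $E\notin\sigma(H_{\Lambda'})$ almost surely, so that $G_{\Lambda'}(\cdot,\cdot;E)$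 is almost surely defined, and $$S^{(1)}_\mu(E):=\sup_{\Lambda'\subseteq\Lambda}\ \sup_{\mathbf x\in\mathcal C_{\Lambda'}}\ \sum_{\mathbf y\in\mathcal C_{\Lambda'}}e^{s\mu|x_1-y_1|}\,\mathbb E\big[|G_{\Lambda'}(\mathbf x,\mathbf y;E)|^s\big]\le C_s^{(1)},$$ $$S^{(2)}_\mu(E):=\sup_{\Lambda'\subseteq\Lambda}\ \sup_{\mathbf x\in\mathcal C_{\Lambda'}}\ \sum_{\mathbf y\in\mathcal X^n_{\Lambda'}}e^{s\mu\overline d(\mathbf x,\mathbf y)}\,\mathbb E\big[|G_{\Lambda'}(\mathbf x,\mathbf y;E)|^s\big]\le C_s^{(2)},$$ where $\overline d$ is formed with the clustered configurations of $\Lambda'$. -/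

import Mathlib

open MeasureTheory ProbabilityTheory Set
open scoped ENNReal

noncomputable section

namespace HardCore

/-- The interval `[-L, L] ∩ ℤ`. -/
def box (L : ℕ) : Finset ℤ := Finset.Icc (-(L : ℤ)) (L : ℤ)

/-- Configurations of `n` hard-core particles on `Λ`: tuples `x₁ < x₂ < … < xₙ` of sites of `Λ`
(the indices run through `Fin n`, so that `x₁` is `x.1 0`). -/
abbrev Config (Λ : Finset ℤ) (n : ℕ) : Type :=
  {x : Fin n → ℤ // StrictMono x ∧ ∀ j, x j ∈ Λ}

instance (Λ : Finset ℤ) (n : ℕ) : Finite (Config Λ n) :=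
  Finite.of_injective (fun (x : Config Λ n) (j : Fin n) => (⟨x.1 j, x.2.2 j⟩ : Λ)) (by
    intro x y h
    apply Subtype.ext
    funext j
    exact congrArg Subtype.val (congrFun h j))

instance (Λ : Finset ℤ) (n : ℕ) : Fintype (Config Λ n) := Fintype.ofFinite _

/-- `B` is a cluster of the finite set of sites `X`: a nonempty set of consecutive sites of `X` that
is not neighbouring any other site of `X`. -/
def IsCluster (X B : Finset ℤ) : Prop :=
  B.Nonempty ∧ B ⊆ X ∧ (∀ a ∈ B, ∀ b ∈ B, Finset.Icc a b ⊆ B) ∧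
    ∀ u ∈ X \ B, ∀ v ∈ B, |u - v| ≠ 1

instance (X B : Finset ℤ) : Decidable (IsCluster X B) := by
  unfold IsCluster; infer_instance

/-- The clusters of a finite set of sites. -/
def clusters (X : Finset ℤ) : Finset (Finset ℤ) := X.powerset.filter (IsCluster X)

namespace Config

variable {Λ : Finset ℤ} {n : ℕ}

/-- The set of occupied sites `{x₁, …, xₙ}`. -/
def sites (x : Config Λ n) : Finset ℤ := Finset.univ.image x.1

/-- The number `k(x)` of clusters of a configuration. -/
def numClusters (x : Config Λ n) : ℕ := (clusters (sites x)).card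

/-- Clustered configurations are those with exactly one cluster. -/
abbrev IsClustered (x : Config Λ n) : Prop := numClusters x = 1

/-- The `ℓ¹`-distance `d(x, y) = ∑ⱼ |xⱼ - yⱼ|`. -/
def l1Dist (x y : Config Λ n) : ℕ := ∑ j, (x.1 j - y.1 j).natAbs

/-- The distance `|x₁ - y₁|` of the leftmost particles. -/
def firstDist [NeZero n] (x y : Config Λ n) : ℕ := (x.1 0 - y.1 0).natAbs

/-- The minimum of `d(x, w) + |w₁ - v₁| + d(v, y)` over clustered configurations `w, v` in `Λ`. -/
def dbar [NeZero n] (x y : Config Λ n) : ℕ :=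
  sInf {m : ℕ | ∃ w v : Config Λ n, IsClustered w ∧ IsClustered v ∧
    m = l1Dist x w + firstDist w v + l1Dist v y}

end Config

open Config

/-- The adjacency (hopping) matrix. -/
def hopping (Λ : Finset ℤ) (n : ℕ) : Matrix (Config Λ n) (Config Λ n) ℝ :=
  Matrix.of fun x y => if l1Dist x y = 1 then 1 else 0

/-- The interaction: multiplication by the number of clusters. -/
def interaction (Λ : Finset ℤ) (n : ℕ) : Matrix (Config Λ n) (Config Λ n) ℝ :=
  Matrix.diagonal fun x => (numClusters x : ℝ)

/-- The potential: multiplication by `∑ⱼ v(xⱼ)`, for a realization `v` of the one-site potentials. -/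
def potential (Λ : Finset ℤ) (n : ℕ) (v : ℤ → ℝ) : Matrix (Config Λ n) (Config Λ n) ℝ :=
  Matrix.diagonal fun x => ∑ j, v (x.1 j)

/-- The Hamiltonian `-A + 2 g U + lam V` in the orthonormal basis `δ_x` of `ℓ²` of the
configurations. -/
def hamiltonian (Λ : Finset ℤ) (n : ℕ) (g lam : ℝ) (v : ℤ → ℝ) :
    Matrix (Config Λ n) (Config Λ n) ℝ :=
  -hopping Λ n + (2 * g) • interaction Λ n + lam • potential Λ n v

/-- The Green function `⟨δ_x, (H - E)⁻¹ δ_y⟩` (meaningful for `E` outside the spectrum). -/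
def green (Λ : Finset ℤ) (n : ℕ) (g lam : ℝ) (v : ℤ → ℝ) (E : ℝ) (x y : Config Λ n) : ℝ :=
  (hamiltonian Λ n g lam v - E • (1 : Matrix (Config Λ n) (Config Λ n) ℝ))⁻¹ x y

/-- The energy `E(g, μT) = 4 g - 12 exp μT`. -/
def energyThreshold (g μT : ℝ) : ℝ := 4 * g - 12 * Real.exp μT

/-- `ρ` is a bounded probability density on `ℝ` that vanishes outside some `[0, ωmax]`. -/
structure IsSiteDensity (ρ : ℝ → ℝ) : Prop where
  nonneg : ∀ᵐ t, 0 ≤ ρ t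
  bounded : MemLp ρ ∞ volume
  integral_eq_one : ∫ t, ρ t = 1
  support : ∃ ωmax : ℝ, ∀ᵐ t, t ∉ Icc 0 ωmax → ρ t = 0

/-- The random variables `ω α`, `α ∈ Λ`, are independent and identically distributed with
density `ρ`. -/
structure IsDisorder {Ω : Type*} [MeasurableSpace Ω] (P : Measure Ω) (Λ : Finset ℤ)
    (ρ : ℝ → ℝ) (ω : ℤ → Ω → ℝ) : Prop where
  measurable : ∀ α ∈ Λ, Measurable (ω α)
  indep : iIndepFun (fun α : Λ => ω α) P
  law : ∀ α ∈ Λ, P.map (ω α) = volume.withDensity fun t => ENNReal.ofReal (ρ t)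

/-- The fractional moment `𝔼[|G_Λ(x, y; E)|^s]`. -/
def fracMoment {Ω : Type*} [MeasurableSpace Ω] (P : Measure Ω) (ω : ℤ → Ω → ℝ)
    (Λ : Finset ℤ) (n : ℕ) (g lam s E : ℝ) (x y : Config Λ n) : ℝ≥0∞ :=
  ∫⁻ a, ENNReal.ofReal (|green Λ n g lam (fun α => ω α a) E x y| ^ s) ∂P

/-- The supremum over `Λ' ⊆ Λ` and clustered `x` in `Λ'` of the sum over clustered `y` in `Λ'` of
`exp (s μ |x₁ - y₁|) 𝔼[|G_Λ'(x, y; E)|^s]`. -/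
def S₁ {Ω : Type*} [MeasurableSpace Ω] (P : Measure Ω) (ω : ℤ → Ω → ℝ)
    (Λ : Finset ℤ) (n : ℕ) [NeZero n] (g lam s μ E : ℝ) : ℝ≥0∞ :=
  ⨆ (Λ' : Finset ℤ) (_ : Λ' ⊆ Λ) (x : Config Λ' n) (_ : IsClustered x),
    ∑ y : Config Λ' n with IsClustered y,
      ENNReal.ofReal (Real.exp (s * μ * firstDist x y)) * fracMoment P ω Λ' n g lam s E x y

/-- The supremum over `Λ' ⊆ Λ` and clustered `x` in `Λ'` of the sum over all `y` in `Λ'` of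
`exp (s μ dbar(x, y)) 𝔼[|G_Λ'(x, y; E)|^s]`. -/
def S₂ {Ω : Type*} [MeasurableSpace Ω] (P : Measure Ω) (ω : ℤ → Ω → ℝ)
    (Λ : Finset ℤ) (n : ℕ) [NeZero n] (g lam s μ E : ℝ) : ℝ≥0∞ :=
  ⨆ (Λ' : Finset ℤ) (_ : Λ' ⊆ Λ) (x : Config Λ' n) (_ : IsClustered x),
    ∑ y : Config Λ' n,
      ENNReal.ofReal (Real.exp (s * μ * dbar x y)) * fracMoment P ω Λ' n g lam s E x y

end HardCore

end

open HardCore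

/-!
Fractional-moment localization for clusters of hard-core particles: a weak `L¹` bound for inverses of
matrix pencils, a uniform partition sum, the deterministic decay away from clusters, and the
decoupling of the particles on either side of a site.
-/

/-! ### Monotonicity of ordered eigenvalues. -/

section WeylMonotonicity

open Matrix
-- A system is compared with strictly smaller ones. If `x` and `y` are distinct clusters, all of `y`
-- lies either to the right of the first particle of `x` or to the left of its last one. Take the
-- first case, with `α` the first site of `x`, and delete `α` together with everything to its left.
-- The geometric resolvent identity writes `G(x, y)` as a sum of terms `G(x, w) G''(q, y)`, with
-- `G''` the Green function of the smaller system and `w → q` a hop across `α`. Only the first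
-- particle can make that hop, so `w` occupies `α` and `q` has its first particle at `α + 1`. Now
-- `x` and `w` both occupy `α`, while `G''` is independent of `ω(α)`, so averaging over `ω(α)`
-- replaces `|G(x, w)|^s` by a constant times `λ^(-s)` (`IsDisorder.fracMoment_le_sum_filter`).
--
-- That a-priori constant must not depend on the dimension. It comes from a weak `L¹` bound for
-- matrix pencils (`Matrix.volume_lt_abs_inv_apply_le`): a level set of the resolvent form is
-- covered by the intervals between the ordered eigenvalues before and after a rank-one
-- perturbation, whose total length is a difference of traces.
--
-- The configuration `q` need not be a cluster. On nonclustered configurations `k ≥ 2`, and below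
-- the threshold energy `H - E` restricted to them is diagonally dominant with enough room for decay
-- at rate `μT`. Hence `G''(q, y)` is bounded by the sum over clusters `z` of `exp(-μT d(z, q))
-- |G''(z, y)|` (`abs_green_le_sum`). Summing over all `z` and all `q` with one particle pinned
-- costs a constant uniform in `n`: `q - z` is a monotone sequence, so this is a partition sum
-- (`sum_pow_sum_natAbs_le_of_monotone`).
--
-- The weighted sum for a system is thus at most `C λ^(-s)` times one plus a constant multiple of
-- the same quantity for smaller systems. For large `λ` the bound `2` propagates by strong induction
-- on the set of sites. One more expansion onto clusters, at the endpoint `y`, gives the second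
-- estimate.
theorem Matrix.IsHermitian.dotProduct_mulVec_eq_sum_eigenvalues {m : Type*} [Fintype m]
    [DecidableEq m] {A : Matrix m m ℝ} (hA : A.IsHermitian) (u : EuclideanSpace ℝ m) :
    u.ofLp ⬝ᵥ (A *ᵥ u.ofLp) =
      ∑ i, hA.eigenvalues i * (inner ℝ (hA.eigenvectorBasis i) u) ^ 2 := by
  have h1 : A *ᵥ u.ofLp = ∑ i, (inner ℝ (hA.eigenvectorBasis i) u * hA.eigenvalues i) •
      (hA.eigenvectorBasis i).ofLp := by
    conv_lhs => rw [← hA.eigenvectorBasis.sum_repr' u]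
    simp only [WithLp.ofLp_sum, WithLp.ofLp_smul, Matrix.mulVec_sum, Matrix.mulVec_smul,
      hA.mulVec_eigenvectorBasis, smul_smul]
  rw [h1, dotProduct_sum]
  refine Finset.sum_congr rfl fun i _ => ?_
  rw [dotProduct_smul]
  have : u.ofLp ⬝ᵥ (hA.eigenvectorBasis i).ofLp = inner ℝ (hA.eigenvectorBasis i) u := by
    simp [EuclideanSpace.inner_eq_star_dotProduct]
  rw [this, smul_eq_mul]; ring

theorem OrthonormalBasis.dotProduct_self_eq_sum {m : Type*} [Fintype m]
    (b : OrthonormalBasis m ℝ (EuclideanSpace ℝ m)) (u : EuclideanSpace ℝ m) :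
    u.ofLp ⬝ᵥ u.ofLp = ∑ i, (inner ℝ (b i) u) ^ 2 := by
  have h := b.sum_sq_inner_left u
  have h2 : u.ofLp ⬝ᵥ u.ofLp = ‖u‖ ^ 2 := by
    rw [EuclideanSpace.real_norm_sq_eq]; simp [dotProduct, sq]
  rw [h2, ← h]
  simp [real_inner_comm]

/-- Weyl's monotonicity of the ordered eigenvalues. -/
theorem Matrix.IsHermitian.eigenvalues_le_of_forall_dotProduct_le {m : Type*} [Fintype m]
    [DecidableEq m] {A B : Matrix m m ℝ} (hA : A.IsHermitian) (hB : B.IsHermitian)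
    (h : ∀ u : m → ℝ, u ⬝ᵥ (A *ᵥ u) ≤ u ⬝ᵥ (B *ᵥ u)) (k : m) :
    hA.eigenvalues k ≤ hB.eigenvalues k := by
  classical
  by_contra! hlt
  -- The same enumeration that turns `eigenvalues₀` into `eigenvalues`, so `eigenvalues₀_antitone`
  -- applies along it.
  let e : Fin (Fintype.card m) ≃ m := Fintype.equivOfCardEq (Fintype.card_fin _)
  -- One linear condition per index other than `k` leaves a nonzero `u` in the span of the top
  -- eigenvectors of `A`, up to `k`, and of the bottom ones of `B`, from `k` on.
  let f : EuclideanSpace ℝ m →ₗ[ℝ] ({i : m // i ≠ k} → ℝ) :=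
    LinearMap.pi fun i => if e.symm i.1 < e.symm k
      then (innerₛₗ ℝ (hB.eigenvectorBasis i.1) : EuclideanSpace ℝ m →ₗ[ℝ] ℝ)
      else (innerₛₗ ℝ (hA.eigenvectorBasis i.1) : EuclideanSpace ℝ m →ₗ[ℝ] ℝ)
  have hcard : Module.finrank ℝ ({i : m // i ≠ k} → ℝ) <
      Module.finrank ℝ (EuclideanSpace ℝ m) := by
    rw [Module.finrank_fintype_fun_eq_card, finrank_euclideanSpace]
    exact Fintype.card_subtype_lt (x := k) (by simp)
  obtain ⟨u, hu, hu0⟩ := (Submodule.ne_bot_iff _).1 (LinearMap.ker_ne_bot_of_finrank_lt (f := f) hcard)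
  have hf : ∀ i : {i : m // i ≠ k}, f u i = 0 := fun i => congrFun hu i
  have hBu : ∀ i, e.symm i < e.symm k → inner ℝ (hB.eigenvectorBasis i) u = 0 := by
    intro i hi
    have := hf ⟨i, fun h => by simp [h] at hi⟩
    simpa [f, hi] using this
  have hAu : ∀ i, e.symm k < e.symm i → inner ℝ (hA.eigenvectorBasis i) u = 0 := by
    intro i hi
    have := hf ⟨i, fun h => by simp [h] at hi⟩
    simpa [f, hi.not_gt] using this
  have hpos : 0 < u.ofLp ⬝ᵥ u.ofLp := by
    have h2 : u.ofLp ⬝ᵥ u.ofLp = ‖u‖ ^ 2 := by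
      rw [EuclideanSpace.real_norm_sq_eq]; simp [dotProduct, sq]
    rw [h2]; have := norm_pos_iff.2 hu0; positivity
  have h1 : hA.eigenvalues k * (u.ofLp ⬝ᵥ u.ofLp) ≤ u.ofLp ⬝ᵥ (A *ᵥ u.ofLp) := by
    rw [hA.dotProduct_mulVec_eq_sum_eigenvalues, hA.eigenvectorBasis.dotProduct_self_eq_sum,
      Finset.mul_sum]
    refine Finset.sum_le_sum fun i _ => ?_
    rcases lt_or_ge (e.symm k) (e.symm i) with hi | hi
    · simp [hAu i hi]
    · exact mul_le_mul_of_nonneg_right (hA.eigenvalues₀_antitone hi) (sq_nonneg _)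
  have h2 : u.ofLp ⬝ᵥ (B *ᵥ u.ofLp) ≤ hB.eigenvalues k * (u.ofLp ⬝ᵥ u.ofLp) := by
    rw [hB.dotProduct_mulVec_eq_sum_eigenvalues, hB.eigenvectorBasis.dotProduct_self_eq_sum,
      Finset.mul_sum]
    refine Finset.sum_le_sum fun i _ => ?_
    rcases lt_or_ge (e.symm i) (e.symm k) with hi | hi
    · simp [hBu i hi]
    · exact mul_le_mul_of_nonneg_right (hB.eigenvalues₀_antitone hi) (sq_nonneg _)
  have h3 := h u.ofLp
  nlinarith [mul_lt_mul_of_pos_right hlt hpos]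

end WeylMonotonicity

/-! ### Dimension-free weak `L¹` bounds for resolvents. -/

section WeakBound

open Matrix
theorem Matrix.IsHermitian.det_smul_one_sub {m : Type*} [Fintype m] [DecidableEq m]
    {A : Matrix m m ℝ} (hA : A.IsHermitian) (v : ℝ) :
    (v • (1 : Matrix m m ℝ) - A).det = ∏ i, (v - hA.eigenvalues i) := by
  have h := Matrix.eval_charpoly A v
  rw [hA.charpoly_eq, Polynomial.eval_prod] at h
  rw [Matrix.smul_one_eq_diagonal]
  simpa [Matrix.scalar_apply] using h.symm

theorem Matrix.det_sub_smul_vecMulVec {m : Type*} [Fintype m] [DecidableEq m]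
    {A : Matrix m m ℝ} (hA : IsUnit A.det) (φ : m → ℝ) (c : ℝ) :
    (A - c • vecMulVec φ φ).det = A.det * (1 - c * (φ ⬝ᵥ (A⁻¹ *ᵥ φ))) := by
  have h := Matrix.det_add_replicateCol_mul_replicateRow (ι := Unit) hA (-c • φ) φ
  have e : replicateCol Unit (-c • φ) * replicateRow Unit φ = - (c • vecMulVec φ φ) := by
    ext i j; simp [Matrix.mul_apply, vecMulVec_apply, mul_assoc]
  have e2 : (replicateRow Unit φ * A⁻¹ * replicateCol Unit (-c • φ)) default default =
      - (c * (φ ⬝ᵥ (A⁻¹ *ᵥ φ))) := by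
    rw [Matrix.mul_assoc, Matrix.mul_apply]
    simp only [dotProduct, Matrix.mulVec, Matrix.mul_apply, replicateRow_apply,
      replicateCol_apply, Pi.smul_apply, smul_eq_mul, Finset.mul_sum, ← Finset.sum_neg_distrib]
    exact Finset.sum_congr rfl fun a _ => Finset.sum_congr rfl fun b _ => by ring
  rw [e, ← sub_eq_add_neg] at h
  rw [h, Matrix.det_unique (n := Unit), Matrix.add_apply, e2, Matrix.one_apply_eq, sub_eq_add_neg]

theorem Matrix.nonsing_inv_neg {m : Type*} [Fintype m] [DecidableEq m] (A : Matrix m m ℝ) :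
    (-A)⁻¹ = -A⁻¹ := by
  by_cases h : IsUnit A.det
  · refine Matrix.inv_eq_right_inv ?_
    rw [neg_mul_neg, Matrix.mul_nonsing_inv _ h]
  · have h' : ¬ IsUnit (-A).det := by
      rw [isUnit_iff_ne_zero] at h ⊢
      simpa [Matrix.det_neg] using h
    rw [Matrix.nonsing_inv_apply_not_isUnit _ h, Matrix.nonsing_inv_apply_not_isUnit _ h', neg_zero]

/-- With `C = B + t⁻¹ φφᵀ`, the matrix determinant lemma makes `det (v - C)` and `det (v - B)`
opposite in sign wherever the form exceeds `t`. Such a `v` must lie between the `i`-th eigenvalues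
of `B` and `C` for some `i`. By Weyl monotonicity these intervals have total length `tr C - tr B`.
-/
theorem Matrix.volume_lt_dotProduct_inv_le {m : Type*} [Fintype m] [DecidableEq m]
    {B : Matrix m m ℝ} (hB : B.IsHermitian) (φ : m → ℝ) {t : ℝ} (ht : 0 < t) :
    volume {v : ℝ | t < φ ⬝ᵥ ((v • (1 : Matrix m m ℝ) - B)⁻¹ *ᵥ φ)} ≤
      ENNReal.ofReal ((φ ⬝ᵥ φ) / t) := by
  have hC : (B + t⁻¹ • vecMulVec φ φ).IsHermitian := by
    refine hB.add ?_
    ext i j; simp [vecMulVec_apply, mul_comm]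
  have hle : ∀ i, hB.eigenvalues i ≤ hC.eigenvalues i := by
    refine fun i => hB.eigenvalues_le_of_forall_dotProduct_le hC (fun u => ?_) i
    rw [Matrix.add_mulVec, dotProduct_add, Matrix.smul_mulVec, dotProduct_smul,
      Matrix.vecMulVec_mulVec, dotProduct_smul]
    have : 0 ≤ t⁻¹ * ((u ⬝ᵥ φ) * (φ ⬝ᵥ u)) := by
      rw [dotProduct_comm φ u]
      exact mul_nonneg (inv_nonneg.2 ht.le) (mul_self_nonneg _)
    simpa using this
  have hsub : {v : ℝ | t < φ ⬝ᵥ ((v • (1 : Matrix m m ℝ) - B)⁻¹ *ᵥ φ)} ⊆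
      ⋃ i ∈ (Finset.univ : Finset m), Set.Icc (hB.eigenvalues i) (hC.eigenvalues i) := by
    intro v hv
    by_contra hnot
    simp only [Finset.mem_univ, Set.iUnion_true, Set.mem_iUnion, Set.mem_Icc, not_exists,
      not_and, not_le] at hnot
    have hu : IsUnit (v • (1 : Matrix m m ℝ) - B).det := by
      by_contra h
      rw [Set.mem_ofPred_eq, Matrix.nonsing_inv_apply_not_isUnit _ h] at hv
      simp at hv; linarith
    have h1 := Matrix.det_sub_smul_vecMulVec hu φ t⁻¹
    rw [sub_sub, hC.det_smul_one_sub, hB.det_smul_one_sub] at h1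
    have h2 : 0 ≤ ∏ i, ((v - hC.eigenvalues i) * (v - hB.eigenvalues i)) := by
      refine Finset.prod_nonneg fun i _ => ?_
      rcases lt_or_ge v (hB.eigenvalues i) with h | h
      · have := hle i; nlinarith
      · have := hnot i h; nlinarith
    rw [Finset.prod_mul_distrib, h1] at h2
    rw [isUnit_iff_ne_zero, hB.det_smul_one_sub] at hu
    have h3 : 1 - t⁻¹ * (φ ⬝ᵥ ((v • (1 : Matrix m m ℝ) - B)⁻¹ *ᵥ φ)) < 0 := by
      have : 1 < t⁻¹ * (φ ⬝ᵥ ((v • (1 : Matrix m m ℝ) - B)⁻¹ *ᵥ φ)) := by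
        rw [inv_mul_eq_div, lt_div_iff₀ ht]; simpa using hv
      linarith
    have h4 : 0 < (∏ i, (v - hB.eigenvalues i)) ^ 2 := by positivity
    nlinarith
  calc _ ≤ ∑ i, volume (Set.Icc (hB.eigenvalues i) (hC.eigenvalues i)) :=
        (measure_mono hsub).trans (measure_biUnion_finset_le _ _)
    _ = ENNReal.ofReal (∑ i, (hC.eigenvalues i - hB.eigenvalues i)) := by
        rw [ENNReal.ofReal_sum_of_nonneg fun i _ => sub_nonneg.2 (hle i)]
        simp
    _ = _ := by
        congr 1
        have h1 := hB.trace_eq_sum_eigenvalues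
        have h2 := hC.trace_eq_sum_eigenvalues
        rw [Matrix.trace_add, h1, Matrix.trace_smul, Matrix.trace_vecMulVec] at h2
        simp only [smul_eq_mul, RCLike.ofReal_real_eq_id, id] at h2
        rw [Finset.sum_sub_distrib, ← h2]
        field_simp; ring

/-- Two-sided form for a pencil `A + v D` with a positive diagonal `D`. -/
theorem Matrix.volume_lt_abs_dotProduct_inv_le {m : Type*} [Fintype m] [DecidableEq m]
    {A : Matrix m m ℝ} (hA : A.IsHermitian) {D : m → ℝ} (hD : ∀ i, 0 < D i) (ψ : m → ℝ)
    {t : ℝ} (ht : 0 < t) :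
    volume {v : ℝ | t < |ψ ⬝ᵥ ((A + v • diagonal D)⁻¹ *ᵥ ψ)|} ≤
      ENNReal.ofReal (2 * (∑ i, ψ i ^ 2 / D i) / t) := by
  -- Conjugating by `D^(-1/2)` turns the pencil into `v + B`, to which the scalar case applies.
  set r : m → ℝ := fun i => (Real.sqrt (D i))⁻¹ with hr
  have hr0 : ∀ i, r i ≠ 0 := fun i => inv_ne_zero (Real.sqrt_pos.2 (hD i)).ne'
  have hrD : ∀ i, r i * D i * r i = 1 := fun i => by
    have := Real.sq_sqrt (hD i).le
    have h0 := (Real.sqrt_pos.2 (hD i)).ne'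
    simp only [hr]; field_simp; exact this.symm
  have hru : IsUnit (diagonal r).det := by
    rw [det_diagonal, isUnit_iff_ne_zero]; exact Finset.prod_ne_zero_iff.2 fun i _ => hr0 i
  set B : Matrix m m ℝ := diagonal r * A * diagonal r with hB
  have hBh : B.IsHermitian := by
    have hAs : ∀ i j, A i j = A j i := fun i j => by simpa using (hA.apply i j).symm
    ext i j
    simp only [hB, conjTranspose_apply, diagonal_mul, mul_diagonal, star_trivial, hAs j i]
    ring
  set φ : m → ℝ := fun i => r i * ψ i with hφ
  have key : ∀ v : ℝ, ψ ⬝ᵥ ((A + v • diagonal D)⁻¹ *ᵥ ψ) =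
      φ ⬝ᵥ ((v • (1 : Matrix m m ℝ) - -B)⁻¹ *ᵥ φ) := by
    intro v
    have e1 : v • (1 : Matrix m m ℝ) - -B = diagonal r * (A + v • diagonal D) * diagonal r := by
      rw [Matrix.mul_add, Matrix.add_mul, ← hB, sub_neg_eq_add, add_comm]
      congr 1
      ext i j
      rw [Matrix.mul_smul, Matrix.smul_mul, diagonal_mul_diagonal, diagonal_mul_diagonal]
      simp only [Matrix.smul_apply, diagonal_apply, one_apply, hrD]
    have e2 : φ = diagonal r *ᵥ ψ := by ext i; simp [hφ, mulVec_diagonal]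
    have e3 : φ = ψ ᵥ* diagonal r := by ext i; simp [hφ, vecMul_diagonal, mul_comm]
    have e4 : (diagonal r * (A + v • diagonal D) * diagonal r)⁻¹ *ᵥ φ =
        (diagonal r)⁻¹ *ᵥ ((A + v • diagonal D)⁻¹ *ᵥ ψ) := by
      rw [Matrix.mul_inv_rev, Matrix.mul_inv_rev, e2, mulVec_mulVec, Matrix.mul_assoc,
        Matrix.mul_assoc, Matrix.nonsing_inv_mul _ hru, Matrix.mul_one, mulVec_mulVec]
    rw [e1, e4, e3, Matrix.dotProduct_mulVec (ψ ᵥ* diagonal r), vecMul_vecMul,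
      Matrix.mul_nonsing_inv _ hru, vecMul_one]
  have hφφ : φ ⬝ᵥ φ = ∑ i, ψ i ^ 2 / D i := by
    refine Finset.sum_congr rfl fun i _ => ?_
    have := hrD i
    have h0 := (hD i).ne'
    simp only [hφ]
    rw [eq_div_iff h0]
    linear_combination (ψ i ^ 2) * this
  -- The reflection `v ↦ -v` exchanges `B` and `-B`, which handles large negative values of the
  -- form.
  have hneg : ∀ v : ℝ, φ ⬝ᵥ ((-v • (1 : Matrix m m ℝ) - B)⁻¹ *ᵥ φ) =
      -(φ ⬝ᵥ ((v • (1 : Matrix m m ℝ) - -B)⁻¹ *ᵥ φ)) := by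
    intro v
    have : -v • (1 : Matrix m m ℝ) - B = -(v • (1 : Matrix m m ℝ) - -B) := by
      rw [neg_smul, sub_neg_eq_add, neg_add, sub_eq_add_neg]
    rw [this, Matrix.nonsing_inv_neg, Matrix.neg_mulVec, dotProduct_neg]
  have hsub : {v : ℝ | t < |ψ ⬝ᵥ ((A + v • diagonal D)⁻¹ *ᵥ ψ)|} ⊆
      {v : ℝ | t < φ ⬝ᵥ ((v • (1 : Matrix m m ℝ) - -B)⁻¹ *ᵥ φ)} ∪
      Neg.neg ⁻¹' {v : ℝ | t < φ ⬝ᵥ ((v • (1 : Matrix m m ℝ) - B)⁻¹ *ᵥ φ)} := by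
    intro v hv
    rw [Set.mem_ofPred_eq, key, lt_abs] at hv
    rcases hv with h | h
    · exact Or.inl h
    · right
      rw [Set.mem_preimage, Set.mem_ofPred_eq, hneg]; exact h
  have hnn : 0 ≤ (φ ⬝ᵥ φ) / t :=
    div_nonneg (Finset.sum_nonneg fun i _ => mul_self_nonneg _) ht.le
  calc _ ≤ _ := (measure_mono hsub).trans (measure_union_le _ _)
    _ ≤ ENNReal.ofReal ((φ ⬝ᵥ φ) / t) + ENNReal.ofReal ((φ ⬝ᵥ φ) / t) := by
        rw [Measure.measure_preimage_neg]
        exact add_le_add (Matrix.volume_lt_dotProduct_inv_le hBh.neg φ ht)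
          (Matrix.volume_lt_dotProduct_inv_le hBh φ ht)
    _ = _ := by
        rw [← ENNReal.ofReal_add hnn hnn, hφφ]; congr 1; ring

/-- Weak `L¹` bound for entries of the inverse of a pencil with a positive diagonal. -/
theorem Matrix.volume_lt_abs_inv_apply_le {m : Type*} [Fintype m] [DecidableEq m]
    {A : Matrix m m ℝ} (hA : A.IsHermitian) {D : m → ℝ} (hD : ∀ i, 0 < D i) {lam : ℝ}
    (hlam : 0 < lam) {x y : m} (hx : lam ≤ D x) (hy : lam ≤ D y) {t : ℝ} (ht : 0 < t) :
    volume {v : ℝ | t < |(A + v • diagonal D)⁻¹ x y|} ≤ ENNReal.ofReal (8 / (lam * t)) := by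
  -- Polarization: four times the entry is a difference of two forms, so one of them exceeds `2 * t`
  -- in absolute value.
  set p : m → ℝ := Pi.single x 1 + Pi.single y 1 with hp
  set q : m → ℝ := Pi.single x 1 - Pi.single y 1 with hq
  have hsymm : ∀ v : ℝ, (A + v • diagonal D)⁻¹ y x = (A + v • diagonal D)⁻¹ x y := by
    intro v
    have : (A + v • diagonal D)ᵀ = A + v • diagonal D := by
      rw [transpose_add, transpose_smul, diagonal_transpose]
      congr 1
    conv_lhs => rw [← this, ← Matrix.transpose_nonsing_inv, transpose_apply]
  have hpol : ∀ v : ℝ, 4 * (A + v • diagonal D)⁻¹ x y =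
      p ⬝ᵥ ((A + v • diagonal D)⁻¹ *ᵥ p) - q ⬝ᵥ ((A + v • diagonal D)⁻¹ *ᵥ q) := by
    intro v
    have := hsymm v
    simp only [hp, hq, mulVec_add, mulVec_sub, dotProduct_add, dotProduct_sub, add_dotProduct,
      sub_dotProduct, mulVec_single_one, single_one_dotProduct, col_apply]
    linarith
  have hsub : {v : ℝ | t < |(A + v • diagonal D)⁻¹ x y|} ⊆
      {v : ℝ | 2 * t < |p ⬝ᵥ ((A + v • diagonal D)⁻¹ *ᵥ p)|} ∪
      {v : ℝ | 2 * t < |q ⬝ᵥ ((A + v • diagonal D)⁻¹ *ᵥ q)|} := by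
    intro v hv
    by_contra hnot
    simp only [Set.mem_union, Set.mem_ofPred_eq, not_or, not_lt] at hnot hv
    have h1 := abs_sub (p ⬝ᵥ ((A + v • diagonal D)⁻¹ *ᵥ p)) (q ⬝ᵥ ((A + v • diagonal D)⁻¹ *ᵥ q))
    rw [← hpol, abs_mul, abs_of_pos (by norm_num : (0:ℝ) < 4)] at h1
    linarith
  -- The factor `2` is that of `(a ± b)² ≤ 2 (a² + b²)`; it also covers `x = y`, where `p` has the
  -- entry `2`.
  have hle : ∀ c : m → ℝ, (∀ i, c i ^ 2 ≤ 2 * ((if i = x then 1 else 0) + if i = y then 1 else 0)) →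
      ∑ i, c i ^ 2 / D i ≤ 4 / lam := by
    intro c hc
    calc ∑ i, c i ^ 2 / D i
        ≤ ∑ i, ((if i = x then 2 / D i else 0) + if i = y then 2 / D i else 0) := by
          refine Finset.sum_le_sum fun i _ => ?_
          refine (div_le_div_of_nonneg_right (hc i) (hD i).le).trans (le_of_eq ?_)
          split_ifs <;> ring
      _ = 2 / D x + 2 / D y := by simp [Finset.sum_add_distrib]
      _ ≤ 2 / lam + 2 / lam := by gcongr
      _ = _ := by ring
  have hpp : ∑ i, p i ^ 2 / D i ≤ 4 / lam := by
    refine hle p fun i => ?_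
    simp only [hp, Pi.add_apply, Pi.single_apply]
    split_ifs <;> norm_num
  have hqq : ∑ i, q i ^ 2 / D i ≤ 4 / lam := by
    refine hle q fun i => ?_
    simp only [hq, Pi.sub_apply, Pi.single_apply]
    split_ifs <;> norm_num
  have hb : ∀ c : m → ℝ, ∑ i, c i ^ 2 / D i ≤ 4 / lam →
      volume {v : ℝ | 2 * t < |c ⬝ᵥ ((A + v • diagonal D)⁻¹ *ᵥ c)|} ≤
        ENNReal.ofReal (4 / (lam * t)) := by
    intro c hc
    refine (Matrix.volume_lt_abs_dotProduct_inv_le hA hD c (by positivity)).trans ?_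
    refine ENNReal.ofReal_le_ofReal ?_
    calc 2 * (∑ i, c i ^ 2 / D i) / (2 * t) ≤ 2 * (4 / lam) / (2 * t) := by gcongr
      _ = _ := by field_simp
  calc _ ≤ _ := (measure_mono hsub).trans (measure_union_le _ _)
    _ ≤ ENNReal.ofReal (4 / (lam * t)) + ENNReal.ofReal (4 / (lam * t)) :=
        add_le_add (hb p hpp) (hb q hqq)
    _ = _ := by
        rw [← ENNReal.ofReal_add (by positivity) (by positivity)]; congr 1; ring

end WeakBound

/-! ### From weak bounds to fractional moments. -/

section FractionalMoments

open Matrix Filter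
open scoped ENNReal Topology
-- Layer-cake formula cut at `lam⁻¹`: below the cut the tail is at most `1`, above it the weak bound
-- is integrable against `t ^ (s - 1)` because `s < 1`.
theorem lintegral_rpow_le_of_meas_lt_le {ν : Measure ℝ} [IsProbabilityMeasure ν] {f : ℝ → ℝ}
    (hf : Measurable f) {b lam s : ℝ} (hb : 0 ≤ b) (hlam : 0 < lam) (hs0 : 0 < s) (hs1 : s < 1)
    (h : ∀ t : ℝ, 0 < t → ν {v | t < |f v|} ≤ ENNReal.ofReal (b / (lam * t))) :
    ∫⁻ v, ENNReal.ofReal (|f v| ^ s) ∂ν ≤ ENNReal.ofReal ((1 + b * s / (1 - s)) * lam ^ (-s)) := by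
  have h1s : 0 < 1 - s := by linarith
  rw [lintegral_rpow_eq_lintegral_meas_lt_mul ν (ae_of_all _ fun v => abs_nonneg (f v))
    hf.abs.aemeasurable hs0]
  have hT : 0 < lam⁻¹ := inv_pos.2 hlam
  rw [← Set.Ioc_union_Ioi_eq_Ioi hT.le, lintegral_union measurableSet_Ioi
    (Set.Ioc_disjoint_Ioi le_rfl)]
  have e1 : ∫⁻ t in Set.Ioc 0 lam⁻¹, ν {a | t < |f a|} * ENNReal.ofReal (t ^ (s - 1)) ≤
      ENNReal.ofReal (lam ^ (-s) / s) := by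
    calc _ ≤ ∫⁻ t in Set.Ioc 0 lam⁻¹, ENNReal.ofReal (t ^ (s - 1)) := by
          refine lintegral_mono fun t => ?_
          exact (mul_le_mul_left prob_le_one _).trans (one_mul _).le
      _ = ENNReal.ofReal (∫ t in Set.Ioc 0 lam⁻¹, t ^ (s - 1)) := by
          rw [ofReal_integral_eq_lintegral_ofReal]
          · exact (intervalIntegrable_iff_integrableOn_Ioc_of_le hT.le).1
              (intervalIntegral.intervalIntegrable_rpow' (by linarith))
          · exact (ae_restrict_mem measurableSet_Ioc).mono fun t ht =>
              Real.rpow_nonneg ht.1.le _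
      _ = _ := by
          rw [← intervalIntegral.integral_of_le hT.le, integral_rpow (Or.inl (by linarith))]
          simp only [sub_add_cancel]
          rw [Real.zero_rpow hs0.ne', sub_zero, Real.inv_rpow hlam.le, Real.rpow_neg hlam.le]
  have e2 : ∫⁻ t in Set.Ioi lam⁻¹, ν {a | t < |f a|} * ENNReal.ofReal (t ^ (s - 1)) ≤
      ENNReal.ofReal (b / (1 - s) * lam ^ (-s)) := by
    calc _ ≤ ∫⁻ t in Set.Ioi lam⁻¹, ENNReal.ofReal ((b / lam) * t ^ (s - 2)) := by
          refine lintegral_mono_ae ((ae_restrict_mem measurableSet_Ioi).mono fun t ht => ?_)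
          have ht0 : 0 < t := hT.trans ht
          refine (mul_le_mul_left (h t ht0) _).trans (le_of_eq ?_)
          rw [← ENNReal.ofReal_mul (by positivity)]
          congr 1
          rw [show s - 2 = (s - 1) - 1 by ring, Real.rpow_sub_one ht0.ne' (s - 1)]
          field_simp
      _ = ENNReal.ofReal (∫ t in Set.Ioi lam⁻¹, (b / lam) * t ^ (s - 2)) := by
          rw [ofReal_integral_eq_lintegral_ofReal]
          · exact (integrableOn_Ioi_rpow_of_lt (by linarith) hT).const_mul _
          · exact (ae_restrict_mem measurableSet_Ioi).mono fun t ht =>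
              mul_nonneg (by positivity) (Real.rpow_nonneg (hT.trans ht).le _)
      _ = _ := by
          rw [integral_const_mul, integral_Ioi_rpow_of_lt (by linarith) hT]
          congr 1
          rw [show s - 2 + 1 = -(1 - s) by ring, Real.inv_rpow hlam.le,
            Real.rpow_neg hlam.le (1 - s), inv_inv, show (1 - s) = 1 + -s by ring,
            Real.rpow_add hlam, Real.rpow_one]
          have : 1 + -s ≠ 0 := by linarith
          field_simp
  have hl : 0 ≤ lam ^ (-s) := Real.rpow_nonneg hlam.le _
  calc _ ≤ ENNReal.ofReal s * (ENNReal.ofReal (lam ^ (-s) / s) +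
        ENNReal.ofReal (b / (1 - s) * lam ^ (-s))) := by gcongr
    _ = _ := by
        rw [← ENNReal.ofReal_add (by positivity) (by positivity), ← ENNReal.ofReal_mul hs0.le]
        congr 1
        field_simp

/-- Cramer's rule with `0⁻¹ = 0` also describes the inverse of a singular matrix, so no
invertibility is needed. -/
theorem Measurable.matrix_inv_apply {α m : Type*} [MeasurableSpace α] [Fintype m] [DecidableEq m]
    {M : α → Matrix m m ℝ} (hM : ∀ i j, Measurable fun a => M a i j) (i j : m) :
    Measurable fun a => (M a)⁻¹ i j := by
  have hdet : ∀ {N : α → Matrix m m ℝ}, (∀ i j, Measurable fun a => N a i j) →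
      Measurable fun a => (N a).det := by
    intro N hN
    simp only [det_apply']
    fun_prop
  have h : ∀ a, (M a)⁻¹ i j = (M a).det⁻¹ * ((M a).updateRow j (Pi.single i 1)).det := by
    intro a
    rw [Matrix.inv_def, Matrix.smul_apply, adjugate_apply, Ring.inverse_eq_inv', smul_eq_mul]
  simp only [h]
  refine (hdet hM).inv.mul (hdet fun k l => ?_)
  by_cases hk : k = j
  · subst hk; simp
  · simp only [updateRow_ne hk]; exact hM k l

/-- Fractional moments of entries of the inverse of a pencil, uniform in the dimension. -/
theorem Matrix.lintegral_abs_inv_apply_rpow_le {m : Type*} [Fintype m] [DecidableEq m]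
    {ν : Measure ℝ} [IsProbabilityMeasure ν] {b : ℝ} (hb : 0 ≤ b)
    (hν : ν ≤ ENNReal.ofReal b • (volume : Measure ℝ))
    {A : Matrix m m ℝ} (hA : A.IsHermitian) {D : m → ℝ} (hD : ∀ i, 0 ≤ D i) {lam s : ℝ}
    (hlam : 0 < lam) (hs0 : 0 < s) (hs1 : s < 1) {x y : m} (hx : lam ≤ D x) (hy : lam ≤ D y) :
    ∫⁻ v, ENNReal.ofReal (|(A + v • diagonal D)⁻¹ x y| ^ s) ∂ν ≤
      ENNReal.ofReal ((1 + 8 * b * s / (1 - s)) * lam ^ (-s)) := by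
  have hmeas : ∀ ε : ℝ, Measurable fun v : ℝ => (A + v • diagonal fun i => D i + ε)⁻¹ x y := by
    intro ε
    refine Measurable.matrix_inv_apply (fun i j => ?_) x y
    simp only [Matrix.add_apply, Matrix.smul_apply, smul_eq_mul]
    fun_prop
  have hpos : ∀ ε : ℝ, 0 < ε →
      ∫⁻ v, ENNReal.ofReal (|(A + v • diagonal fun i => D i + ε)⁻¹ x y| ^ s) ∂ν ≤
      ENNReal.ofReal ((1 + 8 * b * s / (1 - s)) * lam ^ (-s)) := by
    intro ε hε
    refine lintegral_rpow_le_of_meas_lt_le (hmeas ε) (by positivity) hlam hs0 hs1 fun t ht => ?_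
    refine (hν _).trans ?_
    rw [Measure.smul_apply, smul_eq_mul]
    refine (mul_le_mul_right (Matrix.volume_lt_abs_inv_apply_le hA
      (fun i => add_pos_of_nonneg_of_pos (hD i) hε) hlam (x := x) (y := y)
      (by linarith) (by linarith) ht) _).trans (le_of_eq ?_)
    rw [← ENNReal.ofReal_mul hb]
    congr 1; ring
  -- `D` may vanish away from `x` and `y`, so it is made positive by adding `ε k`, and Fatou's lemma
  -- removes the perturbation.
  set ε : ℕ → ℝ := fun k => 1 / ((k : ℝ) + 1) with hε
  have hε0 : ∀ k, 0 < ε k := fun k => by positivity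
  have hlim : Tendsto ε atTop (𝓝 0) := tendsto_one_div_add_atTop_nhds_zero_nat
  have hpt : ∀ v : ℝ, ENNReal.ofReal (|(A + v • diagonal D)⁻¹ x y| ^ s) ≤
      liminf (fun k => ENNReal.ofReal
        (|(A + v • diagonal fun i => D i + ε k)⁻¹ x y| ^ s)) atTop := by
    intro v
    by_cases hu : IsUnit (A + v • diagonal D).det
    · refine le_of_eq (Tendsto.liminf_eq ?_).symm
      refine (ENNReal.continuous_ofReal.tendsto _).comp ?_
      refine ((Real.continuous_rpow_const hs0.le).tendsto _).comp ?_
      refine (continuous_abs.tendsto _).comp ?_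
      have hc : Tendsto (fun k => A + v • diagonal fun i => D i + ε k) atTop
          (𝓝 (A + v • diagonal D)) := by
        have : Continuous fun e : ℝ => A + v • diagonal fun i => D i + e := by fun_prop
        have h := (this.tendsto 0).comp hlim
        simpa [Function.comp_def] using h
      have hdet : Tendsto (fun k => (A + v • diagonal fun i => D i + ε k).det) atTop
          (𝓝 (A + v • diagonal D).det) :=
        ((continuous_id.matrix_det).tendsto _).comp hc
      have hadj : Tendsto (fun k => (A + v • diagonal fun i => D i + ε k).adjugate x y) atTop
          (𝓝 ((A + v • diagonal D).adjugate x y)) :=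
        (((continuous_id.matrix_adjugate).matrix_elem x y).tendsto _).comp hc
      simp only [Matrix.inv_def, Matrix.smul_apply, Ring.inverse_eq_inv', smul_eq_mul]
      exact (hdet.inv₀ hu.ne_zero).mul hadj
    -- At a singular parameter the inverse is `0` by convention, and the inequality is trivial.
    · rw [Matrix.nonsing_inv_apply_not_isUnit _ hu]
      simp [Real.zero_rpow hs0.ne']
  calc _ ≤ ∫⁻ v, liminf (fun k => ENNReal.ofReal
        (|(A + v • diagonal fun i => D i + ε k)⁻¹ x y| ^ s)) atTop ∂ν := lintegral_mono hpt
    _ ≤ liminf (fun k => ∫⁻ v, ENNReal.ofReal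
        (|(A + v • diagonal fun i => D i + ε k)⁻¹ x y| ^ s) ∂ν) atTop :=
        lintegral_liminf_le fun k => ((hmeas _).abs.pow_const s).ennreal_ofReal
    _ ≤ _ := by
        refine (liminf_le_liminf (Eventually.of_forall fun k => hpos (ε k) (hε0 k))).trans ?_
        simp

end FractionalMoments

/-! ### Resolvent identities and Combes–Thomas decay. -/

section Resolvents

open Matrix
/-- Block resolvent identity. -/
theorem Matrix.inv_apply_eq_sum_of_isUnit_submatrix {m : Type*} [Fintype m] [DecidableEq m]
    (M : Matrix m m ℝ) (p : m → Prop) [DecidablePred p]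
    (hp : IsUnit (M.submatrix (Subtype.val : {i // p i} → m) Subtype.val).det)
    {x : m} (hx : ¬ p x) (y : {i // p i}) :
    M⁻¹ x y = -∑ z : {i // ¬ p i}, ∑ q : {i // p i}, M⁻¹ x z * M z q *
      (M.submatrix (Subtype.val : {i // p i} → m) Subtype.val)⁻¹ q y := by
  by_cases hM : IsUnit M.det
  swap
  · rw [Matrix.nonsing_inv_apply_not_isUnit _ hM]; simp
  set N := M.submatrix (Subtype.val : {i // p i} → m) Subtype.val with hN
  have h1 : ∀ q : {i // p i}, ∑ z : {i // p i}, M⁻¹ x z * N z q =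
      -∑ z : {i // ¬ p i}, M⁻¹ x z * M z q := by
    intro q
    have h := congrFun (congrFun (Matrix.nonsing_inv_mul M hM) x) q
    rw [Matrix.mul_apply, Matrix.one_apply_ne (fun h : x = q => hx (h.symm ▸ q.2)),
      ← Fintype.sum_subtype_add_sum_subtype p] at h
    simp only [hN, submatrix_apply]
    linarith
  have h2 : M⁻¹ x y = ∑ q, (∑ z : {i // p i}, M⁻¹ x z * N z q) * N⁻¹ q y := by
    simp only [Finset.sum_mul, mul_assoc]
    rw [Finset.sum_comm]
    simp only [← Finset.mul_sum]
    have h3 : ∀ z : {i // p i}, ∑ q, N z q * N⁻¹ q y = if z = y then 1 else 0 := by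
      intro z
      rw [← Matrix.mul_apply, Matrix.mul_nonsing_inv _ hp, Matrix.one_apply]
    simp [h3]
  rw [h2, Finset.sum_comm]
  simp only [h1, neg_mul, Finset.sum_neg_distrib, Finset.sum_mul]

/-- Weighted decay of the inverse of a row diagonally dominant matrix. -/
theorem Matrix.abs_inv_apply_le_of_diagonally_dominant {m : Type*} [Fintype m] [DecidableEq m]
    {M : Matrix m m ℝ} {d : m → m → ℝ} {κ c : ℝ} (hc : 0 < c) (hκ : 0 ≤ κ)
    (hself : ∀ x, d x x = 0) (hd : ∀ x z y, x ≠ z → M x z ≠ 0 → d x y ≤ 1 + d z y)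
    (hdom : ∀ x, c + Real.exp κ * ∑ z ∈ Finset.univ.erase x, |M x z| ≤ M x x) :
    IsUnit M.det ∧ ∀ x y, |M⁻¹ x y| ≤ c⁻¹ * Real.exp (-(κ * d x y)) := by
  have hu : IsUnit M.det := by
    rw [isUnit_iff_ne_zero]
    refine det_ne_zero_of_sum_row_lt_diag fun k => ?_
    have h1 : ∑ j ∈ Finset.univ.erase k, ‖M k j‖ ≤
        Real.exp κ * ∑ z ∈ Finset.univ.erase k, |M k z| := by
      refine le_mul_of_one_le_left (Finset.sum_nonneg fun _ _ => abs_nonneg _)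
        (Real.one_le_exp hκ)
    have h2 := hdom k
    exact lt_of_lt_of_le (by linarith) (le_abs_self _)
  refine ⟨hu, fun x y => ?_⟩
  set u : m → ℝ := fun x => |M⁻¹ x y| * Real.exp (κ * d x y) with hudef
  suffices h : ∀ x, u x ≤ c⁻¹ by
    have := h x
    rw [Real.exp_neg, ← div_eq_mul_inv, le_div_iff₀ (Real.exp_pos _)]
    exact this
  -- Maximum principle: where the weighted entry is largest, the row equation of `M * M⁻¹ = 1` and
  -- the dominance margin give `c * u x₀ ≤ 1`.
  obtain ⟨x₀, -, hx₀⟩ := Finset.exists_max_image Finset.univ u ⟨x, Finset.mem_univ x⟩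
  refine fun x => (hx₀ x (Finset.mem_univ x)).trans ?_
  have hMG := congrFun (congrFun (Matrix.mul_nonsing_inv M hu) x₀) y
  rw [Matrix.mul_apply, ← Finset.add_sum_erase _ _ (Finset.mem_univ x₀)] at hMG
  have hu0 : 0 ≤ u x₀ := by positivity
  have hsum : Real.exp (κ * d x₀ y) * |∑ z ∈ Finset.univ.erase x₀, M x₀ z * M⁻¹ z y| ≤
      (Real.exp κ * ∑ z ∈ Finset.univ.erase x₀, |M x₀ z|) * u x₀ := by
    calc _ ≤ Real.exp (κ * d x₀ y) * ∑ z ∈ Finset.univ.erase x₀, |M x₀ z| * |M⁻¹ z y| := by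
          gcongr
          refine (Finset.abs_sum_le_sum_abs _ _).trans (le_of_eq ?_)
          exact Finset.sum_congr rfl fun z _ => abs_mul _ _
      _ = ∑ z ∈ Finset.univ.erase x₀, |M x₀ z| * (Real.exp (κ * d x₀ y) * |M⁻¹ z y|) := by
          rw [Finset.mul_sum]; exact Finset.sum_congr rfl fun z _ => by ring
      _ ≤ ∑ z ∈ Finset.univ.erase x₀, |M x₀ z| * (Real.exp κ * u x₀) := by
          refine Finset.sum_le_sum fun z hz => ?_
          by_cases hz0 : M x₀ z = 0
          · simp [hz0]
          refine mul_le_mul_of_nonneg_left ?_ (abs_nonneg _)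
          have hdz := hd x₀ z y (Finset.ne_of_mem_erase hz).symm hz0
          calc _ ≤ Real.exp (κ + κ * d z y) * |M⁻¹ z y| := by
                gcongr; nlinarith
            _ = Real.exp κ * u z := by rw [Real.exp_add, hudef]; ring
            _ ≤ _ := by gcongr; exact hx₀ z (Finset.mem_univ z)
      _ = _ := by rw [← Finset.sum_mul]; ring
  have hone : Real.exp (κ * d x₀ y) * |(1 : Matrix m m ℝ) x₀ y| ≤ 1 := by
    rw [Matrix.one_apply]
    split_ifs with h
    · rw [h, hself]; simp
    · simp
  have hdx := hdom x₀
  have hMx : 0 ≤ M x₀ x₀ := by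
    refine le_trans ?_ hdx
    have : 0 ≤ Real.exp κ * ∑ z ∈ Finset.univ.erase x₀, |M x₀ z| :=
      mul_nonneg (Real.exp_pos _).le (Finset.sum_nonneg fun _ _ => abs_nonneg _)
    linarith
  have hmain : M x₀ x₀ * u x₀ ≤ 1 +
      (Real.exp κ * ∑ z ∈ Finset.univ.erase x₀, |M x₀ z|) * u x₀ := by
    have e : M x₀ x₀ * M⁻¹ x₀ y = (1 : Matrix m m ℝ) x₀ y -
        ∑ z ∈ Finset.univ.erase x₀, M x₀ z * M⁻¹ z y := by linarith
    have e2 : M x₀ x₀ * u x₀ = Real.exp (κ * d x₀ y) * |M x₀ x₀ * M⁻¹ x₀ y| := by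
      rw [abs_mul, abs_of_nonneg hMx, hudef]; ring
    rw [e2, e]
    calc _ ≤ Real.exp (κ * d x₀ y) * (|(1 : Matrix m m ℝ) x₀ y| +
          |∑ z ∈ Finset.univ.erase x₀, M x₀ z * M⁻¹ z y|) := by
          gcongr; exact abs_sub _ _
      _ ≤ _ := by rw [mul_add]; linarith
  rw [← one_div, le_div_iff₀ hc]
  nlinarith [mul_le_mul_of_nonneg_right hdx hu0]

/-- If a block is invertible and `D` is positive exactly off that block, the pencil is singular for
at most finitely many parameters. -/
theorem Matrix.finite_setOf_not_isUnit_det_pencil {m : Type*} [Fintype m] [DecidableEq m]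
    (A : Matrix m m ℝ) (D : m → ℝ) (p : m → Prop) [DecidablePred p] {lam : ℝ} (hlam : lam ≠ 0)
    (hDp : ∀ i, p i → D i = 0) (hDn : ∀ i, ¬ p i → D i = lam)
    (hp : IsUnit (A.submatrix (Subtype.val : {i // p i} → m) Subtype.val).det) :
    {v : ℝ | ¬ IsUnit (A + v • diagonal D).det}.Finite := by
  set a := A.submatrix (Subtype.val : {i // p i} → m) Subtype.val with ha
  set e := Equiv.sumCompl p
  -- Schur complement onto the complementary block. The parameter enters there as `v * lam` times
  -- the identity, so up to the factor `a.det` the determinant is a characteristic polynomial in `v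
  -- * lam`.
  set K : Matrix {i // ¬ p i} {i // ¬ p i} ℝ :=
    A.submatrix (Subtype.val : {i // ¬ p i} → m) (Subtype.val : {i // ¬ p i} → m) -
      A.submatrix (Subtype.val : {i // ¬ p i} → m) (Subtype.val : {i // p i} → m) * a⁻¹ *
      A.submatrix (Subtype.val : {i // p i} → m) (Subtype.val : {i // ¬ p i} → m) with hK
  let : Invertible a := Matrix.invertibleOfIsUnitDet a hp
  have hdet : ∀ v : ℝ, (A + v • diagonal D).det = a.det * ((v * lam) • (1 : Matrix _ _ ℝ) + K).det := by
    intro v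
    rw [← Matrix.det_submatrix_equiv_self e]
    have : (A + v • diagonal D).submatrix e e = fromBlocks a (A.submatrix Subtype.val Subtype.val)
        (A.submatrix Subtype.val Subtype.val)
        (A.submatrix Subtype.val Subtype.val + (v * lam) • (1 : Matrix _ _ ℝ)) := by
      ext i j
      rcases i with i | i <;> rcases j with j | j
      · simp [e, ha, diagonal_apply, hDp i i.2]
      · simp [e, diagonal_apply, hDp i i.2]
      · have : (i : m) ≠ j := fun h => i.2 (h ▸ j.2)
        simp [e, this]
      · simp only [e, submatrix_apply, Equiv.sumCompl_apply_inr, Matrix.add_apply,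
          Matrix.smul_apply, diagonal_apply, fromBlocks_apply₂₂, one_apply, hDn i i.2,
          Subtype.ext_iff, smul_eq_mul]
        split_ifs <;> simp
    rw [this, Matrix.det_fromBlocks₁₁, Matrix.invOf_eq_nonsing_inv, hK]
    congr 2
    abel
  have hfin : {w : ℝ | (-K).charpoly.eval w = 0}.Finite :=
    (Polynomial.finite_setOfPred_isRoot (Matrix.charpoly_monic (-K)).ne_zero)
  refine Set.Finite.subset (hfin.preimage
    (f := fun v : ℝ => v * lam) (fun v _ w _ h => mul_right_cancel₀ hlam h)) fun v hv => ?_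
  simp only [Set.mem_ofPred_eq, hdet, isUnit_iff_ne_zero, not_not, mul_eq_zero, hp.ne_zero,
    false_or] at hv
  rw [Set.mem_preimage, Set.mem_ofPred_eq, Matrix.eval_charpoly, ← hv]
  congr 1
  rw [Matrix.smul_one_eq_diagonal, Matrix.scalar_apply, sub_neg_eq_add]

end Resolvents

/-! ### Partition sums uniform in the number of particles. -/

section PartitionSums

theorem Monotone.eq_of_card_fiber_eq {n : ℕ} {δ ε : Fin n → ℤ} (hδ : Monotone δ) (hε : Monotone ε)
    (h : ∀ v : ℤ, (Finset.univ.filter fun j => δ j = v).card =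
      (Finset.univ.filter fun j => ε j = v).card) : δ = ε := by
  have hperm : (List.ofFn δ).Perm (List.ofFn ε) := by
    have hc : ∀ (f : Fin n → ℤ) (v : ℤ), (List.ofFn f).count v =
        (Finset.univ.filter fun j => f j = v).card := by
      intro f v
      rw [← Multiset.coe_count, ← Fin.univ_val_map, Multiset.count_map, Finset.card_def,
        Finset.filter_val]
      simp only [eq_comm]
    rw [List.perm_iff_count]
    intro v
    rw [hc, hc, h]
  exact List.ofFn_injective (hperm.eq_of_sortedLE hδ.sortedLE_ofFn hε.sortedLE_ofFn)

/-- Each factor is at most `(1 - t)⁻¹ ≤ exp (t / (1 - t))` with `t = q ^ |v| ≤ q`. The exponents are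
summable because each absolute value is taken by at most two `v`. -/
theorem prod_geom_sum_le_exp {q : ℝ} (hq0 : 0 < q) (hq1 : q < 1) (V : Finset ℤ)
    (hV : (0 : ℤ) ∉ V) (n : ℕ) :
    ∏ v ∈ V, ∑ k ∈ Finset.range n, q ^ (v.natAbs * k) ≤ Real.exp (2 / (1 - q) ^ 2) := by
  have h1q : 0 < 1 - q := by linarith
  have hsum : ∑ v ∈ V, q ^ v.natAbs ≤ 2 / (1 - q) := by
    have hinj : ∀ W : Finset ℤ, Set.InjOn Int.natAbs W →
        ∑ v ∈ W, q ^ v.natAbs ≤ (1 - q)⁻¹ := by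
      intro W hW
      rw [← Finset.sum_image (f := fun k => q ^ k) hW, ← tsum_geometric_of_lt_one hq0.le hq1]
      exact (summable_geometric_of_lt_one hq0.le hq1).sum_le_tsum _ fun k _ => by positivity
    rw [← Finset.sum_filter_add_sum_filter_not V (fun v => 0 < v)]
    have h1 := hinj (V.filter fun v => 0 < v) fun a ha b hb h => by
      simp only [Finset.coe_filter, Set.mem_ofPred_eq] at ha hb; omega
    have h2 := hinj (V.filter fun v => ¬ 0 < v) fun a ha b hb h => by
      simp only [Finset.coe_filter, Set.mem_ofPred_eq] at ha hb; omega
    rw [div_eq_mul_inv]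
    linarith
  calc ∏ v ∈ V, ∑ k ∈ Finset.range n, q ^ (v.natAbs * k)
      ≤ ∏ v ∈ V, Real.exp (q ^ v.natAbs / (1 - q)) := by
        refine Finset.prod_le_prod (fun v _ => Finset.sum_nonneg fun k _ => by positivity)
          fun v hv => ?_
        have hv0 : v.natAbs ≠ 0 := fun h => hV (Int.natAbs_eq_zero.1 h ▸ hv)
        set t := q ^ v.natAbs with ht
        have ht0 : 0 < t := by positivity
        have htq : t ≤ q := pow_le_of_le_one hq0.le hq1.le hv0
        have ht1 : 0 < 1 - t := by linarith
        have h1 : ∑ k ∈ Finset.range n, q ^ (v.natAbs * k) ≤ (1 - t)⁻¹ := by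
          simp only [pow_mul]
          rw [← ht, ← tsum_geometric_of_lt_one ht0.le (by linarith)]
          exact (summable_geometric_of_lt_one ht0.le (by linarith)).sum_le_tsum _
            fun k _ => by positivity
        refine h1.trans ?_
        have h2 : (1 - t)⁻¹ ≤ Real.exp (t / (1 - t)) := by
          have := Real.add_one_le_exp (t / (1 - t))
          refine le_trans (le_of_eq ?_) this
          field_simp; ring
        refine h2.trans (Real.exp_le_exp.2 ?_)
        gcongr
    _ = Real.exp ((∑ v ∈ V, q ^ v.natAbs) / (1 - q)) := by
        rw [← Real.exp_sum, Finset.sum_div]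
    _ ≤ _ := by
        refine Real.exp_le_exp.2 ?_
        rw [div_le_iff₀ h1q]
        refine hsum.trans (le_of_eq ?_)
        field_simp

/-- Summing `q ^ ∑ |δ j|` over monotone integer sequences of length `n` is bounded uniformly
in `n`. -/
theorem sum_pow_sum_natAbs_le_of_monotone {q : ℝ} (hq0 : 0 < q) (hq1 : q < 1) {n : ℕ}
    (S : Finset (Fin n → ℤ)) (hS : ∀ δ ∈ S, Monotone δ) :
    ∑ δ ∈ S, q ^ (∑ j, (δ j).natAbs) ≤ Real.exp (2 / (1 - q) ^ 2) := by
  classical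
  set M : ℕ := ∑ δ ∈ S, ∑ j, (δ j).natAbs
  -- The value `0` is omitted: it has no weight, and its multiplicity is forced by the total `n`. A
  -- monotone sequence is therefore encoded by its multiplicities on `V`, and the sum factors into
  -- geometric series.
  set V : Finset ℤ := (Finset.Icc (-(M : ℤ)) M).erase 0 with hV
  have hmem : ∀ δ ∈ S, ∀ j, δ j ∈ Finset.Icc (-(M : ℤ)) M := by
    intro δ hδ j
    have h1 : (δ j).natAbs ≤ ∑ j, (δ j).natAbs :=
      Finset.single_le_sum (f := fun j => (δ j).natAbs) (fun _ _ => Nat.zero_le _)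
        (Finset.mem_univ j)
    have h2 : ∑ j, (δ j).natAbs ≤ M :=
      Finset.single_le_sum (f := fun δ : Fin n → ℤ => ∑ j, (δ j).natAbs)
        (fun _ _ => Nat.zero_le _) hδ
    rw [Finset.mem_Icc]; omega
  set c : (Fin n → ℤ) → ℤ → ℕ := fun δ v => (Finset.univ.filter fun j => δ j = v).card with hc
  have hsumc : ∀ δ ∈ S, ∑ j, (δ j).natAbs = ∑ v ∈ V, v.natAbs * c δ v := by
    intro δ hδ
    rw [← Finset.sum_fiberwise_of_maps_to (fun j _ => hmem δ hδ j), hV,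
      Finset.sum_erase _ (by simp)]
    refine Finset.sum_congr rfl fun v _ => ?_
    rw [Finset.sum_congr rfl (g := fun _ => v.natAbs)
      (fun j hj => by rw [(Finset.mem_filter.1 hj).2]), Finset.sum_const, smul_eq_mul, mul_comm]
  have htot : ∀ δ ∈ S, c δ 0 + ∑ v ∈ V, c δ v = n := by
    intro δ hδ
    have h0 : (0 : ℤ) ∈ Finset.Icc (-(M : ℤ)) M := by simp
    rw [hV, Finset.add_sum_erase _ _ h0,
      ← Finset.card_eq_sum_card_fiberwise (fun j _ => hmem δ hδ j)]
    simp
  let φ : (Fin n → ℤ) → (V → ℕ) := fun δ v => c δ v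
  have hφ : Set.InjOn φ S := by
    intro δ hδ ε hε h
    refine (hS δ hδ).eq_of_card_fiber_eq (hS ε hε) fun v => ?_
    have hVeq : ∀ v ∈ V, c δ v = c ε v := fun v hv => congrFun h ⟨v, hv⟩
    change c δ v = c ε v
    by_cases hv : v ∈ V
    · exact hVeq v hv
    by_cases hv0 : v = 0
    · have h1 := htot δ hδ
      have h2 := htot ε hε
      have h3 : ∑ v ∈ V, c δ v = ∑ v ∈ V, c ε v := Finset.sum_congr rfl hVeq
      rw [hv0]; omega
    · have hv' : v ∉ Finset.Icc (-(M : ℤ)) M := fun h => hv (Finset.mem_erase.2 ⟨hv0, h⟩)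
      have hz : ∀ δ ∈ S, c δ v = 0 := by
        intro δ hδ
        rw [hc, Finset.card_eq_zero, Finset.filter_eq_empty_iff]
        exact fun j _ hj => hv' (hj ▸ hmem δ hδ j)
      rw [hz δ hδ, hz ε hε]
  calc ∑ δ ∈ S, q ^ (∑ j, (δ j).natAbs)
      = ∑ δ ∈ S, ∏ v : V, q ^ ((v : ℤ).natAbs * φ δ v) := by
        refine Finset.sum_congr rfl fun δ hδ => ?_
        rw [hsumc δ hδ, Finset.prod_pow_eq_pow_sum, ← Finset.sum_coe_sort V]
    _ = ∑ p ∈ S.image φ, ∏ v : V, q ^ ((v : ℤ).natAbs * p v) := by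
        rw [Finset.sum_image hφ]
    _ ≤ ∑ p ∈ Fintype.piFinset (fun _ : V => Finset.range (n + 1)),
          ∏ v : V, q ^ ((v : ℤ).natAbs * p v) := by
        refine Finset.sum_le_sum_of_subset_of_nonneg (fun p hp => ?_) fun p _ _ =>
          Finset.prod_nonneg fun v _ => by positivity
        obtain ⟨δ, hδ, rfl⟩ := Finset.mem_image.1 hp
        rw [Fintype.mem_piFinset]
        intro v
        rw [Finset.mem_range, Nat.lt_succ_iff]
        exact (Finset.card_le_univ _).trans (by simp)
    _ = ∏ v ∈ V, ∑ k ∈ Finset.range (n + 1), q ^ (v.natAbs * k) := by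
        rw [← Finset.prod_coe_sort V, Finset.prod_univ_sum]
    _ ≤ _ := prod_geom_sum_le_exp hq0 hq1 V (by simp [hV]) _

end PartitionSums

noncomputable section

namespace HardCore

open Config

/-! ### Clusters and the hopping graph. -/

section Clusters

/-- The cluster of `X` that contains `a`. -/
def clusterOf (X : Finset ℤ) (a : ℤ) : Finset ℤ := X.filter fun b => Finset.uIcc a b ⊆ X

theorem isCluster_clusterOf {X : Finset ℤ} {a : ℤ} (ha : a ∈ X) : IsCluster X (clusterOf X a) := by
  have hmem : ∀ b, b ∈ clusterOf X a ↔ Finset.uIcc a b ⊆ X := by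
    intro b
    rw [clusterOf, Finset.mem_filter]
    exact ⟨fun h => h.2, fun h => ⟨h Finset.right_mem_uIcc, h⟩⟩
  refine ⟨⟨a, by rw [hmem]; simpa using ha⟩, Finset.filter_subset _ _, ?_, ?_⟩
  · intro u hu v hv w hw
    rw [hmem] at hu hv ⊢
    rw [Finset.mem_Icc] at hw
    intro c hc
    rw [Finset.mem_uIcc'] at hc
    rcases hc with hc | hc
    · exact hv (Finset.mem_uIcc'.2 (by omega))
    · exact hu (Finset.mem_uIcc'.2 (by omega))
  · intro u hu v hv huv
    rw [Finset.mem_sdiff, hmem] at hu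
    rw [hmem] at hv
    refine hu.2 fun c hc => ?_
    by_cases hcu : c = u
    · exact hcu ▸ hu.1
    · rw [Finset.mem_uIcc'] at hc
      refine hv (Finset.mem_uIcc'.2 ?_)
      rcases abs_eq (by norm_num : (0 : ℤ) ≤ 1) |>.1 huv with h | h <;> omega

theorem clusterOf_mem_clusters {X : Finset ℤ} {a : ℤ} (ha : a ∈ X) :
    clusterOf X a ∈ clusters X := by
  rw [clusters, Finset.mem_filter, Finset.mem_powerset]
  exact ⟨(isCluster_clusterOf ha).2.1, isCluster_clusterOf ha⟩

theorem uIcc_subset_of_clusterOf_eq {X : Finset ℤ} {a b : ℤ} (hb : b ∈ X)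
    (h : clusterOf X a = clusterOf X b) : Finset.uIcc a b ⊆ X := by
  have hb' : b ∈ clusterOf X b := by simp [clusterOf, hb]
  rw [← h, clusterOf, Finset.mem_filter] at hb'
  exact hb'.2

/-- The sites of `X` from which a hop by `σ` is possible. -/
def hopSites (X : Finset ℤ) (σ : ℤ) : Finset ℤ := X.filter fun a => a + σ ∉ X

/-- Each cluster has only one end in direction `σ`: for two sites of one cluster, the interval
between them is occupied and contains the `σ`-neighbour of one of them. -/
theorem card_hopSites_le (X : Finset ℤ) {σ : ℤ} (hσ : σ = 1 ∨ σ = -1) :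
    (hopSites X σ).card ≤ (clusters X).card := by
  refine Finset.card_le_card_of_injOn (clusterOf X)
    (fun a ha => clusterOf_mem_clusters (Finset.mem_filter.1 ha).1) ?_
  intro a ha b hb h
  have ha' := Finset.mem_filter.1 (Finset.mem_coe.1 ha)
  have hb' := Finset.mem_filter.1 (Finset.mem_coe.1 hb)
  have h1 := uIcc_subset_of_clusterOf_eq hb'.1 h
  by_contra hab
  have hor : (a + σ ∈ Finset.uIcc a b) ∨ (b + σ ∈ Finset.uIcc a b) := by
    rw [Finset.mem_uIcc', Finset.mem_uIcc']; omega
  rcases hor with h | h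
  · exact ha'.2 (h1 h)
  · exact hb'.2 (h1 h)

namespace Config

variable {Λ : Finset ℤ} {n : ℕ}

theorem mem_sites (x : Config Λ n) (j : Fin n) : x.1 j ∈ sites x :=
  Finset.mem_image_of_mem _ (Finset.mem_univ j)

theorem l1Dist_self (x : Config Λ n) : l1Dist x x = 0 := by simp [l1Dist]

theorem l1Dist_comm (x y : Config Λ n) : l1Dist x y = l1Dist y x :=
  Finset.sum_congr rfl fun j _ => by omega

theorem l1Dist_triangle (x y z : Config Λ n) : l1Dist x z ≤ l1Dist x y + l1Dist y z := by
  rw [l1Dist, l1Dist, l1Dist, ← Finset.sum_add_distrib]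
  exact Finset.sum_le_sum fun j _ => by omega

theorem natAbs_sub_le_l1Dist (x y : Config Λ n) (j : Fin n) :
    (x.1 j - y.1 j).natAbs ≤ l1Dist x y :=
  Finset.single_le_sum (f := fun j => (x.1 j - y.1 j).natAbs) (fun _ _ => Nat.zero_le _)
    (Finset.mem_univ j)

theorem exists_hop_of_l1Dist_eq_one {x y : Config Λ n} (h : l1Dist x y = 1) :
    ∃ a σ : ℤ, (σ = 1 ∨ σ = -1) ∧ a ∈ hopSites (sites x) σ ∧
      ∀ i, y.1 i = if x.1 i = a then a + σ else x.1 i := by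
  have hex : ∃ j, (x.1 j - y.1 j).natAbs ≠ 0 := by
    by_contra! h0
    simp [l1Dist, h0] at h
  obtain ⟨j, hj⟩ := hex
  rw [l1Dist, ← Finset.add_sum_erase _ _ (Finset.mem_univ j)] at h
  have hrest : ∀ i, i ≠ j → y.1 i = x.1 i := by
    intro i hi
    have h0 : ∑ i ∈ Finset.univ.erase j, (x.1 i - y.1 i).natAbs = 0 := by omega
    have := Finset.sum_eq_zero_iff.1 h0 i (Finset.mem_erase.2 ⟨hi, Finset.mem_univ i⟩)
    omega
  refine ⟨x.1 j, y.1 j - x.1 j, by omega, ?_, fun i => ?_⟩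
  · rw [hopSites, Finset.mem_filter]
    refine ⟨mem_sites x j, fun hm => ?_⟩
    obtain ⟨i, -, hi⟩ := Finset.mem_image.1 hm
    by_cases hij : i = j
    · subst hij; omega
    · have h1 := hrest i hij
      exact hij (y.2.1.injective (by omega))
  · by_cases hi : i = j
    · subst hi; simp
    · rw [if_neg fun h => hi (x.2.1.injective h), hrest i hi]

/-- A neighbour is determined by the direction of the hop and the site it leaves, and every cluster
offers one such site in each direction. -/
theorem card_l1Dist_eq_one_le (x : Config Λ n) :
    (Finset.univ.filter fun y : Config Λ n => l1Dist x y = 1).card ≤ 2 * numClusters x := by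
  classical
  choose! a σ hσ hm hy using fun (y : Config Λ n) (h : l1Dist x y = 1) =>
    exists_hop_of_l1Dist_eq_one h
  set T : Finset (ℤ × ℤ) := ({1} : Finset ℤ) ×ˢ hopSites (sites x) 1 ∪
    ({-1} : Finset ℤ) ×ˢ hopSites (sites x) (-1) with hT
  have h1 : (Finset.univ.filter fun y : Config Λ n => l1Dist x y = 1).card ≤ T.card := by
    refine Finset.card_le_card_of_injOn (fun y => (σ y, a y)) ?_ ?_
    · intro y h
      have h := (Finset.mem_filter.1 (Finset.mem_coe.1 h)).2
      have h2 := hm y h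
      rcases hσ y h with h3 | h3 <;> rw [h3] at h2 <;> simp [hT, h3, h2]
    · intro y h z h' heq
      have h := (Finset.mem_filter.1 (Finset.mem_coe.1 h)).2
      have h' := (Finset.mem_filter.1 (Finset.mem_coe.1 h')).2
      have e1 : σ y = σ z := congrArg Prod.fst heq
      have e2 : a y = a z := congrArg Prod.snd heq
      exact Subtype.ext (funext fun i => by rw [hy y h, hy z h', e1, e2])
  refine h1.trans ((Finset.card_union_le _ _).trans ?_)
  have h2 := card_hopSites_le (sites x) (σ := 1) (Or.inl rfl)
  have h3 := card_hopSites_le (sites x) (σ := -1) (Or.inr rfl)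
  rw [Finset.card_product, Finset.card_product, Finset.card_singleton, Finset.card_singleton,
    numClusters]
  omega

theorem one_le_numClusters [NeZero n] (x : Config Λ n) : 1 ≤ numClusters x :=
  Finset.card_pos.2 ⟨_, clusterOf_mem_clusters (mem_sites x 0)⟩

theorem IsClustered.apply_eq [NeZero n] {x : Config Λ n} (hx : IsClustered x) (j : Fin n) :
    x.1 j = x.1 0 + (j : ℕ) := by
  obtain ⟨B, hB⟩ := Finset.card_eq_one.1 hx
  have hsub : ∀ i, Finset.uIcc (x.1 0) (x.1 i) ⊆ sites x := by
    intro i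
    have h1 := clusterOf_mem_clusters (mem_sites x 0)
    have h2 := clusterOf_mem_clusters (mem_sites x i)
    rw [hB, Finset.mem_singleton] at h1 h2
    exact uIcc_subset_of_clusterOf_eq (mem_sites x i) (h1.trans h2.symm)
  obtain ⟨k, hk⟩ := j
  induction k with
  | zero => simp [show (⟨0, hk⟩ : Fin n) = 0 from rfl]
  | succ k ih =>
    have hk' : k < n := by omega
    have h1 := ih hk'
    have h2 : x.1 ⟨k, hk'⟩ < x.1 ⟨k + 1, hk⟩ := x.2.1 (by simp)
    by_contra hne
    simp only at h1 hne
    push_cast at hne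
    have h3 : x.1 ⟨k, hk'⟩ + 1 ∈ sites x :=
      hsub ⟨k + 1, hk⟩ (Finset.mem_uIcc'.2 (by omega))
    obtain ⟨i, -, hi⟩ := Finset.mem_image.1 h3
    have h4 : (⟨k, hk'⟩ : Fin n) < i := x.2.1.lt_iff_lt.1 (by omega)
    have h5 : i < (⟨k + 1, hk⟩ : Fin n) := x.2.1.lt_iff_lt.1 (by omega)
    rw [Fin.lt_def] at h4 h5
    simp only at h4 h5
    omega

theorem _root_.StrictMono.sub_le_sub_fin {f : Fin n → ℤ} (hf : StrictMono f) {i j : Fin n}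
    (hij : i ≤ j) : ((j : ℕ) : ℤ) - (i : ℕ) ≤ f j - f i := by
  obtain ⟨k, hk⟩ := j
  induction k with
  | zero =>
    obtain rfl : i = ⟨0, hk⟩ := Fin.ext (Nat.le_zero.1 (Fin.le_def.1 hij))
    simp
  | succ k ih =>
    rcases hij.eq_or_lt with rfl | hlt
    · simp
    · have h1 := ih (by omega) (Fin.le_def.2 (Nat.lt_succ_iff.1 (Fin.lt_def.1 hlt)))
      have h2 : f ⟨k, by omega⟩ < f ⟨k + 1, hk⟩ := hf (by simp)
      push_cast at h1 ⊢
      omega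

/-- The gaps of `z` are exactly `1` and those of `y` at least `1`. This is what turns sums over
configurations around a cluster into partition sums. -/
theorem IsClustered.monotone_sub [NeZero n] {Λ' : Finset ℤ} {z : Config Λ' n}
    (hz : IsClustered z) (y : Config Λ n) : Monotone fun j => y.1 j - z.1 j := by
  intro i j hij
  have h1 := y.2.1.sub_le_sub_fin hij
  have h2 := hz.apply_eq i
  have h3 := hz.apply_eq j
  simp only
  omega

end Config

end Clusters

/-! ### Green functions, deletion of sites, and decay away from clusters. -/

section GreenFunctions

variable {Λ : Finset ℤ} {n : ℕ}

/-- `H_Λ - E`. -/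
def shifted (Λ : Finset ℤ) (n : ℕ) (g lam : ℝ) (v : ℤ → ℝ) (E : ℝ) :
    Matrix (Config Λ n) (Config Λ n) ℝ :=
  hamiltonian Λ n g lam v - E • (1 : Matrix (Config Λ n) (Config Λ n) ℝ)

theorem green_eq (g lam : ℝ) (v : ℤ → ℝ) (E : ℝ) (x y : Config Λ n) :
    green Λ n g lam v E x y = (shifted Λ n g lam v E)⁻¹ x y := rfl

theorem shifted_apply (g lam : ℝ) (v : ℤ → ℝ) (E : ℝ) (x y : Config Λ n) :
    shifted Λ n g lam v E x y = -(if l1Dist x y = 1 then 1 else 0) +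
      if x = y then 2 * g * numClusters x + lam * ∑ j, v (x.1 j) - E else 0 := by
  simp only [shifted, hamiltonian, hopping, interaction, potential, Matrix.sub_apply,
    Matrix.add_apply, Matrix.neg_apply, Matrix.smul_apply, Matrix.of_apply, Matrix.diagonal_apply,
    Matrix.one_apply, smul_eq_mul]
  split_ifs <;> ring

theorem shifted_apply_self (g lam : ℝ) (v : ℤ → ℝ) (E : ℝ) (x : Config Λ n) :
    shifted Λ n g lam v E x x = 2 * g * numClusters x + lam * ∑ j, v (x.1 j) - E := by
  simp [shifted_apply, l1Dist_self]

theorem shifted_apply_of_ne (g lam : ℝ) (v : ℤ → ℝ) (E : ℝ) {x y : Config Λ n} (h : x ≠ y) :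
    shifted Λ n g lam v E x y = -(if l1Dist x y = 1 then 1 else 0) := by
  simp [shifted_apply, h]

theorem shifted_comm (g lam : ℝ) (v : ℤ → ℝ) (E : ℝ) (x y : Config Λ n) :
    shifted Λ n g lam v E x y = shifted Λ n g lam v E y x := by
  rcases eq_or_ne x y with rfl | h
  · rfl
  · rw [shifted_apply_of_ne _ _ _ _ h, shifted_apply_of_ne _ _ _ _ h.symm, l1Dist_comm]

theorem shifted_isHermitian (g lam : ℝ) (v : ℤ → ℝ) (E : ℝ) :
    (shifted Λ n g lam v E).IsHermitian := by
  ext x y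
  simp [shifted_comm g lam v E y x]

theorem green_comm (g lam : ℝ) (v : ℤ → ℝ) (E : ℝ) (x y : Config Λ n) :
    green Λ n g lam v E x y = green Λ n g lam v E y x := by
  have h : (shifted Λ n g lam v E).transpose = shifted Λ n g lam v E := by
    ext x y; exact shifted_comm g lam v E y x
  rw [green_eq, green_eq]
  conv_lhs => rw [← h, ← Matrix.transpose_nonsing_inv, Matrix.transpose_apply]

theorem shifted_congr (g lam : ℝ) {u v : ℤ → ℝ} (E : ℝ) (h : ∀ β ∈ Λ, u β = v β) :
    shifted Λ n g lam u E = shifted Λ n g lam v E := by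
  ext x y
  simp only [shifted_apply, h _ (x.2.2 _)]

theorem green_congr (g lam : ℝ) {u v : ℤ → ℝ} (E : ℝ) (h : ∀ β ∈ Λ, u β = v β)
    (x y : Config Λ n) : green Λ n g lam u E x y = green Λ n g lam v E x y := by
  rw [green_eq, green_eq, shifted_congr g lam E h]

theorem measurable_shifted {Ω : Type*} [MeasurableSpace Ω] (g lam E : ℝ) {v : Ω → ℤ → ℝ}
    (hv : ∀ β ∈ Λ, Measurable fun a => v a β) (x y : Config Λ n) :
    Measurable fun a => shifted Λ n g lam (v a) E x y := by
  have : ∀ j, Measurable fun a => v a (x.1 j) := fun j => hv _ (x.2.2 j)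
  simp only [shifted_apply]
  split_ifs <;> fun_prop

theorem measurable_green {Ω : Type*} [MeasurableSpace Ω] (g lam E : ℝ) {v : Ω → ℤ → ℝ}
    (hv : ∀ β ∈ Λ, Measurable fun a => v a β) (x y : Config Λ n) :
    Measurable fun a => green Λ n g lam (v a) E x y :=
  Measurable.matrix_inv_apply (measurable_shifted g lam E hv) x y

/-- The Hamiltonian is affine in the potential at one site. -/
theorem shifted_update (g lam : ℝ) (v : ℤ → ℝ) (E : ℝ) (α : ℤ) (t : ℝ) :
    shifted Λ n g lam (Function.update v α t) E = shifted Λ n g lam (Function.update v α 0) E +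
      t • Matrix.diagonal fun x : Config Λ n => if α ∈ sites x then lam else 0 := by
  have hsum : ∀ x : Config Λ n, ∑ j, Function.update v α t (x.1 j) =
      (∑ j, Function.update v α 0 (x.1 j)) + t * if α ∈ sites x then 1 else 0 := by
    intro x
    have h1 : ∀ j, Function.update v α t (x.1 j) =
        Function.update v α 0 (x.1 j) + if x.1 j = α then t else 0 := by
      intro j
      by_cases h : x.1 j = α
      · simp [h]
      · simp [h]
    simp only [h1, Finset.sum_add_distrib]
    congr 1
    split_ifs with hα
    · obtain ⟨i, -, rfl⟩ := Finset.mem_image.1 hα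
      simp [x.2.1.injective.eq_iff]
    · rw [mul_zero]
      exact Finset.sum_eq_zero fun j _ => if_neg fun h : x.1 j = α => hα (h ▸ mem_sites x j)
  ext x y
  rw [Matrix.add_apply, Matrix.smul_apply, shifted_apply, shifted_apply, Matrix.diagonal_apply,
    hsum]
  rcases eq_or_ne x y with rfl | hxy
  · have hc : (if α ∈ sites x then lam else 0) = lam * if α ∈ sites x then 1 else 0 := by
      rw [mul_ite, mul_one, mul_zero]
    rw [if_pos rfl, if_pos rfl, if_pos rfl, hc, smul_eq_mul]
    ring
  · rw [if_neg hxy, if_neg hxy, if_neg hxy, smul_zero, add_zero, add_zero]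

/-- The coefficient of the potential at `α` is diagonal, equal to `lam` on configurations occupying
`α` and zero elsewhere. The pencil bound only needs it to be large at the two endpoints. -/
theorem lintegral_green_update_le {ν : Measure ℝ} [IsProbabilityMeasure ν] {b : ℝ} (hb : 0 ≤ b)
    (hν : ν ≤ ENNReal.ofReal b • (volume : Measure ℝ)) {g lam s E : ℝ} (hlam : 0 < lam)
    (hs0 : 0 < s) (hs1 : s < 1) (v : ℤ → ℝ) {α : ℤ} {x y : Config Λ n} (hx : α ∈ sites x)
    (hy : α ∈ sites y) :
    ∫⁻ t, ENNReal.ofReal (|green Λ n g lam (Function.update v α t) E x y| ^ s) ∂ν ≤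
      ENNReal.ofReal ((1 + 8 * b * s / (1 - s)) * lam ^ (-s)) := by
  refine le_trans (le_of_eq (lintegral_congr fun t => ?_))
    (Matrix.lintegral_abs_inv_apply_rpow_le hb hν
      (shifted_isHermitian (Λ := Λ) (n := n) g lam (Function.update v α 0) E)
      (D := fun x => if α ∈ sites x then lam else 0) (fun i => ?_) hlam hs0 hs1
      (if_pos hx).ge (if_pos hy).ge)
  · rw [green_eq, shifted_update]
  · by_cases hi : α ∈ sites i
    · exact (if_pos hi).symm ▸ hlam.le
    · exact (if_neg hi).ge

/-- Configurations all of whose sites satisfy `r`. -/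
def configFilterEquiv (Λ : Finset ℤ) (n : ℕ) (r : ℤ → Prop) [DecidablePred r] :
    {w : Config Λ n // ∀ j, r (w.1 j)} ≃ Config (Λ.filter r) n where
  toFun w := ⟨w.1.1, w.1.2.1, fun j => Finset.mem_filter.2 ⟨w.1.2.2 j, w.2 j⟩⟩
  invFun w := ⟨⟨w.1, w.2.1, fun j => (Finset.mem_filter.1 (w.2.2 j)).1⟩,
    fun j => (Finset.mem_filter.1 (w.2.2 j)).2⟩
  left_inv _ := rfl
  right_inv _ := rfl

/-- Hopping, cluster count and potential depend only on the occupied sites, so compressing to the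
configurations that avoid some sites gives exactly the smaller Hamiltonian, with no boundary term.
-/
theorem shifted_submatrix (g lam : ℝ) (v : ℤ → ℝ) (E : ℝ) (r : ℤ → Prop) [DecidablePred r] :
    (shifted Λ n g lam v E).submatrix
      (Subtype.val : {w : Config Λ n // ∀ j, r (w.1 j)} → Config Λ n) Subtype.val =
    (shifted (Λ.filter r) n g lam v E).submatrix (configFilterEquiv Λ n r)
      (configFilterEquiv Λ n r) := by
  ext x y
  rw [Matrix.submatrix_apply, Matrix.submatrix_apply, shifted_apply, shifted_apply]
  have h1 : l1Dist (configFilterEquiv Λ n r x) (configFilterEquiv Λ n r y) =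
      l1Dist x.1 y.1 := rfl
  have h2 : numClusters (configFilterEquiv Λ n r x) = numClusters x.1 := rfl
  have h3 : (configFilterEquiv Λ n r x).1 = x.1.1 := rfl
  rw [h1, h2, h3]
  simp only [EmbeddingLike.apply_eq_iff_eq, Subtype.ext_iff]

/-- Geometric resolvent identity for removing the sites where `r` fails. -/
theorem green_eq_sum_of_filter (g lam : ℝ) (v : ℤ → ℝ) (E : ℝ) (r : ℤ → Prop) [DecidablePred r]
    (hu : IsUnit (shifted (Λ.filter r) n g lam v E).det) {x : Config Λ n}
    (hx : ¬ ∀ j, r (x.1 j)) (y : {w : Config Λ n // ∀ j, r (w.1 j)}) :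
    green Λ n g lam v E x y = ∑ w : {w : Config Λ n // ¬ ∀ j, r (w.1 j)},
      ∑ q : {w : Config Λ n // ∀ j, r (w.1 j)}, green Λ n g lam v E x w *
        (if l1Dist w.1 q.1 = 1 then 1 else 0) * green (Λ.filter r) n g lam v E
          (configFilterEquiv Λ n r q) (configFilterEquiv Λ n r y) := by
  have hsub := shifted_submatrix (Λ := Λ) (n := n) g lam v E r
  rw [green_eq, Matrix.inv_apply_eq_sum_of_isUnit_submatrix _ (fun w : Config Λ n => ∀ j, r (w.1 j))
    (by rw [hsub, Matrix.det_submatrix_equiv_self]; exact hu) hx y, hsub,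
    Matrix.inv_submatrix_equiv, ← Finset.sum_neg_distrib]
  refine Finset.sum_congr rfl fun w _ => ?_
  rw [← Finset.sum_neg_distrib]
  refine Finset.sum_congr rfl fun q _ => ?_
  rw [shifted_apply_of_ne _ _ _ _ (fun h : w.1 = q.1 => w.2 (h ▸ q.2)), green_eq, green_eq,
    Matrix.submatrix_apply]
  ring

/-- Deterministic expansion of the Green function onto clustered configurations. -/
theorem abs_green_le_sum [NeZero n] {g lam μT E : ℝ} {v : ℤ → ℝ} (hlam : 0 ≤ lam) (hμT : 0 ≤ μT)
    (hv : ∀ β ∈ Λ, 0 ≤ v β) (hg : 0 < energyThreshold g μT) (hE : E < energyThreshold g μT)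
    {x : Config Λ n} (hx : IsClustered x) (y : Config Λ n) :
    |green Λ n g lam v E x y| ≤ ∑ z : Config Λ n with IsClustered z,
      Real.exp (-(μT * l1Dist z y)) * |green Λ n g lam v E x z| := by
  by_cases hy : IsClustered y
  · have h := Finset.single_le_sum
      (f := fun z : Config Λ n => Real.exp (-(μT * l1Dist z y)) * |green Λ n g lam v E x z|)
      (s := Finset.univ.filter fun z => IsClustered z)
      (fun z _ => by positivity) (Finset.mem_filter.2 ⟨Finset.mem_univ y, hy⟩)
    simpa [l1Dist_self] using h
  set p : Config Λ n → Prop := fun w => ¬ IsClustered w with hp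
  set N := (shifted Λ n g lam v E).submatrix (Subtype.val : {w // p w} → _) Subtype.val with hN
  have he : 0 < Real.exp μT := Real.exp_pos _
  have hdeg : ∀ w : Config Λ n, (∑ z, if l1Dist w z = 1 then (1 : ℝ) else 0) ≤
      2 * numClusters w := by
    intro w
    rw [Finset.sum_boole]
    exact_mod_cast card_l1Dist_eq_one_le w
  have hsubsum : ∀ w : Config Λ n, (∑ q : {w // p w}, if l1Dist w q.1 = 1 then (1 : ℝ) else 0) ≤
      2 * numClusters w := by
    intro w
    refine le_trans ?_ (hdeg w)
    rw [← Fintype.sum_subtype_add_sum_subtype p]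
    exact le_add_of_nonneg_right (Finset.sum_nonneg fun z _ => by split_ifs <;> norm_num)
  -- With `e = exp μT`, dominance asks for `8e + 2ke ≤ 2gk - E`. Since `E < 4g - 12e`, it follows
  -- from `2(g - e)(k - 2) ≥ 0`, which holds as `k ≥ 2` and `g > 3e`. The `12` in the threshold is
  -- thus this `8` plus the `2k = 4` neighbours at `k = 2`.
  obtain ⟨hu, hdecay⟩ := Matrix.abs_inv_apply_le_of_diagonally_dominant (M := N)
    (d := fun w z => (l1Dist w.1 z.1 : ℝ)) (κ := μT) (c := 8 * Real.exp μT) (by positivity) hμT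
    (fun w => by simp [l1Dist_self])
    (fun w z y hwz h => by
      rw [hN, Matrix.submatrix_apply, shifted_apply_of_ne _ _ _ _ (Subtype.coe_ne_coe.2 hwz)] at h
      have h1 : l1Dist w.1 z.1 = 1 := by
        by_contra h2; simp [h2] at h
      have := l1Dist_triangle w.1 z.1 y.1
      rw [h1] at this
      exact_mod_cast this)
    (fun w => by
      have hk : 2 ≤ numClusters w.1 := by
        have h1 := one_le_numClusters w.1
        have h2 : numClusters w.1 ≠ 1 := w.2
        omega
      have hk' : (2 : ℝ) ≤ numClusters w.1 := by exact_mod_cast hk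
      have hsum : ∑ z ∈ Finset.univ.erase w, |N w z| ≤ 2 * numClusters w.1 := by
        refine le_trans ?_ (hsubsum w.1)
        refine le_trans (le_of_eq (Finset.sum_congr rfl fun z hz => ?_))
          (Finset.sum_le_sum_of_subset_of_nonneg (Finset.erase_subset _ _)
            fun z _ _ => by split_ifs <;> norm_num)
        rw [hN, Matrix.submatrix_apply, shifted_apply_of_ne _ _ _ _
          (Subtype.coe_ne_coe.2 (Finset.ne_of_mem_erase hz).symm)]
        split_ifs <;> simp
      have hV : 0 ≤ lam * ∑ j, v (w.1.1 j) :=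
        mul_nonneg hlam (Finset.sum_nonneg fun j _ => hv _ (w.1.2.2 j))
      rw [hN, Matrix.submatrix_apply, shifted_apply_self, ← hN]
      simp only [energyThreshold] at hg hE
      nlinarith [mul_le_mul_of_nonneg_left hsum he.le])
  rw [green_eq, Matrix.inv_apply_eq_sum_of_isUnit_submatrix _ p hu (not_not.2 hx) ⟨y, hy⟩, abs_neg]
  rw [Finset.sum_subtype (Finset.univ.filter fun z : Config Λ n => IsClustered z)
    (p := fun z => ¬ p z) (fun z => by simp [hp])]
  refine (Finset.abs_sum_le_sum_abs _ _).trans (Finset.sum_le_sum fun z _ => ?_)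
  have hz : numClusters z.1 = 1 := not_not.1 z.2
  calc |∑ q : {w // p w}, (shifted Λ n g lam v E)⁻¹ x z * shifted Λ n g lam v E z q *
        N⁻¹ q ⟨y, hy⟩|
      ≤ ∑ q : {w // p w}, (if l1Dist z.1 q.1 = 1 then (1 : ℝ) else 0) *
          (8⁻¹ * Real.exp (-(μT * l1Dist z.1 y)) * |green Λ n g lam v E x z|) := by
        refine (Finset.abs_sum_le_sum_abs _ _).trans (Finset.sum_le_sum fun q _ => ?_)
        rw [abs_mul, abs_mul, shifted_apply_of_ne _ _ _ _ (fun h : z.1 = q.1 => z.2 (h ▸ q.2)),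
          ← green_eq]
        split_ifs with h1
        · have h2 : (l1Dist z.1 y : ℝ) ≤ 1 + l1Dist q.1 y := by
            have := l1Dist_triangle z.1 q.1 y
            rw [h1] at this
            exact_mod_cast this
          have h3 : |N⁻¹ q ⟨y, hy⟩| ≤ 8⁻¹ * Real.exp (-(μT * l1Dist z.1 y)) := by
            refine (hdecay q ⟨y, hy⟩).trans ?_
            rw [mul_inv, ← Real.exp_neg, mul_assoc, ← Real.exp_add]
            gcongr
            nlinarith
          rw [abs_neg, abs_one, mul_one, one_mul, mul_comm]
          gcongr
        · simp
    _ = (∑ q : {w // p w}, if l1Dist z.1 q.1 = 1 then (1 : ℝ) else 0) *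
          (8⁻¹ * Real.exp (-(μT * l1Dist z.1 y)) * |green Λ n g lam v E x z|) :=
        (Finset.sum_mul _ _ _).symm
    -- A single cluster has at most two neighbours, so the total factor `2 / 8` is below `1`.
    _ ≤ 2 * (8⁻¹ * Real.exp (-(μT * l1Dist z.1 y)) * |green Λ n g lam v E x z|) := by
        gcongr
        refine (hsubsum z.1).trans ?_
        rw [hz]; norm_num
    _ ≤ _ := by
        have : 0 ≤ Real.exp (-(μT * l1Dist z.1 y)) * |green Λ n g lam v E x z| := by positivity
        linarith

end GreenFunctions

/-! ### Averaging over the potential at one site. -/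

section Disorder

/-- The law of a single site potential. -/
def siteLaw (ρ : ℝ → ℝ) : Measure ℝ := volume.withDensity fun t => ENNReal.ofReal (ρ t)

theorem IsSiteDensity.exists_siteLaw_le {ρ : ℝ → ℝ} (hρ : IsSiteDensity ρ) :
    ∃ b : ℝ, 0 ≤ b ∧ siteLaw ρ ≤ ENNReal.ofReal b • (volume : Measure ℝ) := by
  have hfin : eLpNormEssSup ρ volume ≠ ∞ := by
    have := hρ.bounded.2.ne
    rwa [eLpNorm_exponent_top] at this
  refine ⟨(eLpNormEssSup ρ volume).toReal, ENNReal.toReal_nonneg, ?_⟩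
  rw [ENNReal.ofReal_toReal hfin, ← withDensity_const]
  refine withDensity_mono ?_
  filter_upwards [enorm_ae_le_eLpNormEssSup ρ volume] with t ht
  exact (Real.ofReal_le_enorm _).trans ht

theorem IsSiteDensity.siteLaw_Iio_zero {ρ : ℝ → ℝ} (hρ : IsSiteDensity ρ) :
    siteLaw ρ (Iio 0) = 0 := by
  obtain ⟨w, hw⟩ := hρ.support
  rw [siteLaw, withDensity_apply _ measurableSet_Iio, lintegral_eq_zero_iff']
  · refine (ae_restrict_iff' measurableSet_Iio).2 ?_
    filter_upwards [hw] with t ht ht0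
    have : ρ t = 0 := ht fun h => absurd h.1 (not_le.2 ht0)
    simp [this]
  · exact hρ.bounded.1.aemeasurable.ennreal_ofReal.restrict

variable {Ω : Type*} [MeasurableSpace Ω] {P : Measure Ω} {Λ : Finset ℤ} {ρ : ℝ → ℝ}
  {ω : ℤ → Ω → ℝ}

theorem IsDisorder.isProbabilityMeasure_siteLaw [IsProbabilityMeasure P]
    (h : IsDisorder P Λ ρ ω) {α : ℤ} (hα : α ∈ Λ) : IsProbabilityMeasure (siteLaw ρ) := by
  rw [siteLaw, ← h.law α hα]
  exact Measure.isProbabilityMeasure_map (h.measurable α hα).aemeasurable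

theorem IsDisorder.ae_nonneg (h : IsDisorder P Λ ρ ω) (hρ : IsSiteDensity ρ) :
    ∀ᵐ a ∂P, ∀ α ∈ Λ, 0 ≤ ω α a := by
  refine (ae_ball_iff Λ.countable_toSet).2 ?_
  intro α hα
  have h1 : P (ω α ⁻¹' Iio 0) = 0 := by
    rw [← Measure.map_apply (h.measurable α hα) measurableSet_Iio, h.law α hα]
    exact hρ.siteLaw_Iio_zero
  refine measure_mono_null (fun a ha => ?_) h1
  simpa using ha

/-- By independence the joint law of the potential at `α` and the remaining ones is a product.
Fubini then integrates out `α` first, with `F₂` constant in that variable. -/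
theorem IsDisorder.lintegral_mul_le [IsProbabilityMeasure P] (h : IsDisorder P Λ ρ ω) {α : ℤ}
    (hα : α ∈ Λ) {F₁ F₂ : (ℤ → ℝ) → ℝ≥0∞} (hF₁ : Measurable F₁) (hF₂ : Measurable F₂)
    (hloc₁ : ∀ u v, (∀ β ∈ Λ, u β = v β) → F₁ u = F₁ v)
    (hloc₂ : ∀ u v, (∀ β ∈ Λ, β ≠ α → u β = v β) → F₂ u = F₂ v) {C : ℝ≥0∞}
    (hC : ∀ u, ∫⁻ t, F₁ (Function.update u α t) ∂(siteLaw ρ) ≤ C) :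
    ∫⁻ a, F₁ (fun β => ω β a) * F₂ (fun β => ω β a) ∂P ≤
      C * ∫⁻ a, F₂ (fun β => ω β a) ∂P := by
  classical
  -- Extension by zero is harmless: `F₁` reads only sites of `Λ`, its value at `α` is restored by
  -- `Function.update`, and `F₂` ignores `α`.
  let ext : ({β // β ∈ Λ.erase α} → ℝ) → ℤ → ℝ := fun u β => if hβ : β ∈ Λ.erase α then u ⟨β, hβ⟩ else 0
  let X : Ω → ({β // β ∈ Λ.erase α} → ℝ) := fun a β => ω β a
  have hext : Measurable ext := by
    refine measurable_pi_lambda _ fun β => ?_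
    by_cases hβ : β ∈ Λ.erase α
    · simp only [ext, hβ, dite_true]; exact measurable_pi_apply _
    · simp only [ext, hβ, dite_false]; exact measurable_const
  have hX : Measurable X :=
    measurable_pi_lambda _ fun β => h.measurable β (Finset.mem_of_mem_erase β.2)
  have hωα := h.measurable α hα
  have hind : IndepFun (ω α) X P := by
    have h1 := h.indep.indepFun_finset {(⟨α, hα⟩ : Λ)} (Finset.univ.erase ⟨α, hα⟩)
      (by simp) (fun β => h.measurable β β.2)
    have hφ : Measurable fun u : ({(⟨α, hα⟩ : Λ)} : Finset Λ) → ℝ =>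
        u ⟨⟨α, hα⟩, Finset.mem_singleton_self _⟩ := measurable_pi_apply _
    refine h1.comp (φ := fun u => u ⟨⟨α, hα⟩, Finset.mem_singleton_self _⟩)
      (ψ := fun u (β : {β // β ∈ Λ.erase α}) => u ⟨⟨β, Finset.mem_of_mem_erase β.2⟩, by
        simpa [Subtype.ext_iff] using Finset.ne_of_mem_erase β.2⟩) hφ ?_
    exact measurable_pi_lambda _ fun β => measurable_pi_apply _
  have hupd : Measurable fun p : ℝ × ({β // β ∈ Λ.erase α} → ℝ) =>
      Function.update (ext p.2) α p.1 := by
    refine measurable_pi_lambda _ fun β => ?_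
    by_cases hβ : β = α
    · subst hβ; simpa using measurable_fst
    · simp only [Function.update_of_ne hβ]
      exact (measurable_pi_apply β).comp (hext.comp measurable_snd)
  have e1 : ∀ a, F₁ (fun β => ω β a) = F₁ (Function.update (ext (X a)) α (ω α a)) := by
    refine fun a => hloc₁ _ _ fun β hβ => ?_
    by_cases hβα : β = α
    · subst hβα; simp
    · simp [hβα, ext, X, hβ]
  have e2 : ∀ a, F₂ (fun β => ω β a) = F₂ (ext (X a)) := by
    refine fun a => hloc₂ _ _ fun β hβ hβα => ?_
    simp [hβα, ext, X, hβ]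
  have hpair : P.map (fun a => (ω α a, X a)) = (siteLaw ρ).prod (P.map X) := by
    rw [(indepFun_iff_map_prod_eq_prod_map_map hωα.aemeasurable hX.aemeasurable).1 hind,
      h.law α hα, siteLaw]
  have : IsProbabilityMeasure (siteLaw ρ) := h.isProbabilityMeasure_siteLaw hα
  have : IsProbabilityMeasure (P.map X) := Measure.isProbabilityMeasure_map hX.aemeasurable
  have hm1 : Measurable fun p : ℝ × ({β // β ∈ Λ.erase α} → ℝ) =>
      F₁ (Function.update (ext p.2) α p.1) := hF₁.comp hupd
  have hm2 : Measurable fun p : ℝ × ({β // β ∈ Λ.erase α} → ℝ) => F₂ (ext p.2) :=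
    hF₂.comp (hext.comp measurable_snd)
  have hm12 : Measurable fun p : ℝ × ({β // β ∈ Λ.erase α} → ℝ) =>
      F₁ (Function.update (ext p.2) α p.1) * F₂ (ext p.2) := hm1.mul hm2
  have hm2' : Measurable fun u => F₂ (ext u) := hF₂.comp hext
  calc ∫⁻ a, F₁ (fun β => ω β a) * F₂ (fun β => ω β a) ∂P
      = ∫⁻ p, F₁ (Function.update (ext p.2) α p.1) * F₂ (ext p.2)
          ∂(P.map fun a => (ω α a, X a)) := by
        rw [lintegral_map hm12 (hωα.prodMk hX)]
        simp only [e1, e2]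
    _ = ∫⁻ u, (∫⁻ t, F₁ (Function.update (ext u) α t) ∂(siteLaw ρ)) * F₂ (ext u) ∂(P.map X) := by
        rw [hpair, lintegral_prod_symm _ hm12.aemeasurable]
        refine lintegral_congr fun u => ?_
        have hm3 : Measurable fun t => F₁ (Function.update (ext u) α t) :=
          hm1.comp (measurable_id.prodMk measurable_const)
        exact lintegral_mul_const (F₂ (ext u)) hm3
    _ ≤ ∫⁻ u, C * F₂ (ext u) ∂(P.map X) :=
        lintegral_mono fun u => mul_le_mul_left (hC _) _
    _ = C * ∫⁻ a, F₂ (fun β => ω β a) ∂P := by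
        rw [lintegral_const_mul _ hm2', lintegral_map hm2' hX]
        simp only [e2]

end Disorder

/-! ### Expansions of fractional moments. -/

section Expansions

theorem ofReal_abs_sum_rpow_le {ι : Type*} (S : Finset ι) (f : ι → ℝ) {s : ℝ} (hs0 : 0 < s)
    (hs1 : s ≤ 1) :
    ENNReal.ofReal (|∑ i ∈ S, f i| ^ s) ≤ ∑ i ∈ S, ENNReal.ofReal (|f i| ^ s) := by
  classical
  induction S using Finset.induction_on with
  | empty => simp [Real.zero_rpow hs0.ne']
  | insert a S ha ih =>
    rw [Finset.sum_insert ha, Finset.sum_insert ha]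
    refine le_trans ?_ (add_le_add_right ih _)
    rw [← ENNReal.ofReal_add (by positivity) (by positivity)]
    refine ENNReal.ofReal_le_ofReal ?_
    exact (Real.rpow_le_rpow (abs_nonneg _) (abs_add_le _ _) hs0.le).trans
      (Real.rpow_add_le_add_rpow (abs_nonneg _) (abs_nonneg _) hs0.le hs1)

theorem ofReal_abs_mul_rpow (a b s : ℝ) :
    ENNReal.ofReal (|a * b| ^ s) = ENNReal.ofReal (|a| ^ s) * ENNReal.ofReal (|b| ^ s) := by
  rw [abs_mul, Real.mul_rpow (abs_nonneg _) (abs_nonneg _), ENNReal.ofReal_mul (by positivity)]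

section Combinatorics

variable {Λ : Finset ℤ} {n : ℕ}

/-- The uniform bound on sums of `exp (-δ d)` over configurations around a cluster. -/
def partitionBound (δ : ℝ) : ℝ := Real.exp (2 / (1 - Real.exp (-δ)) ^ 2)

/-- The weight depends on a pair only through its difference, a monotone sequence. Injectivity of
the difference reduces the sum to the partition sum. -/
theorem sum_exp_l1Dist_le [NeZero n] {δ : ℝ} (hδ : 0 < δ) (S : Finset (Config Λ n × Config Λ n))
    (hS : ∀ p ∈ S, IsClustered p.1)
    (hinj : Set.InjOn (fun p : Config Λ n × Config Λ n => fun j => p.2.1 j - p.1.1 j) S) :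
    ∑ p ∈ S, ENNReal.ofReal (Real.exp (-(δ * l1Dist p.1 p.2))) ≤
      ENNReal.ofReal (partitionBound δ) := by
  classical
  rw [← ENNReal.ofReal_sum_of_nonneg fun p _ => (Real.exp_pos _).le]
  refine ENNReal.ofReal_le_ofReal ?_
  have h := sum_pow_sum_natAbs_le_of_monotone (q := Real.exp (-δ)) (Real.exp_pos _)
    (Real.exp_lt_one_iff.2 (by linarith))
    (S.image fun p : Config Λ n × Config Λ n => fun j => p.2.1 j - p.1.1 j) (by
      intro d hd
      obtain ⟨p, hp, rfl⟩ := Finset.mem_image.1 hd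
      exact (hS p hp).monotone_sub p.2)
  rw [Finset.sum_image hinj] at h
  refine le_trans (le_of_eq (Finset.sum_congr rfl fun p _ => ?_)) h
  rw [← Real.exp_nat_mul, l1Dist_comm]
  congr 1
  simp only [l1Dist]
  ring

theorem sum_exp_l1Dist_le_of_isClustered [NeZero n] {δ : ℝ} (hδ : 0 < δ) {z : Config Λ n}
    (hz : IsClustered z) :
    ∑ y : Config Λ n, ENNReal.ofReal (Real.exp (-(δ * l1Dist z y))) ≤
      ENNReal.ofReal (partitionBound δ) := by
  have h := sum_exp_l1Dist_le hδ ({z} ×ˢ (Finset.univ : Finset (Config Λ n)))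
    (fun p hp => by
      rw [Finset.mem_singleton.1 (Finset.mem_product.1 hp).1]; exact hz)
    (fun p hp q hq h => by
      have h1 : p.1 = z := Finset.mem_singleton.1 (Finset.mem_product.1 hp).1
      have h2 : q.1 = z := Finset.mem_singleton.1 (Finset.mem_product.1 hq).1
      refine Prod.ext (h1.trans h2.symm) (Subtype.ext (funext fun j => ?_))
      have := congrFun h j
      simp only [h1, h2] at this
      omega)
  rwa [Finset.sum_product, Finset.sum_singleton] at h

/-- Pinning one particle of `q` removes translation invariance: the difference at `i` gives `z.1 i`,
hence the whole cluster `z`, hence `q`. -/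
theorem sum_exp_l1Dist_le_of_apply_eq [NeZero n] {δ : ℝ} (hδ : 0 < δ) (i : Fin n) (a : ℤ) :
    ∑ z : Config Λ n with IsClustered z, ∑ q : Config Λ n with q.1 i = a,
      ENNReal.ofReal (Real.exp (-(δ * l1Dist z q))) ≤ ENNReal.ofReal (partitionBound δ) := by
  have h := sum_exp_l1Dist_le hδ
    ((Finset.univ.filter fun z : Config Λ n => IsClustered z) ×ˢ
      (Finset.univ.filter fun q : Config Λ n => q.1 i = a))
    (fun p hp => (Finset.mem_filter.1 (Finset.mem_product.1 hp).1).2)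
    (fun p hp q hq h => by
      have hp := Finset.mem_product.1 (Finset.mem_coe.1 hp)
      have hq := Finset.mem_product.1 (Finset.mem_coe.1 hq)
      have h1 := (Finset.mem_filter.1 hp.1).2
      have h2 := (Finset.mem_filter.1 hq.1).2
      have h3 := (Finset.mem_filter.1 hp.2).2
      have h4 := (Finset.mem_filter.1 hq.2).2
      have h5 := congrFun h i
      simp only at h5
      have h6 := h1.apply_eq i
      have h7 := h2.apply_eq i
      have e1 : p.1 = q.1 := Subtype.ext (funext fun j => by
        have h8 := h1.apply_eq j
        have h9 := h2.apply_eq j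
        omega)
      refine Prod.ext e1 (Subtype.ext (funext fun j => ?_))
      have := congrFun h j
      simp only [e1] at this
      omega)
  rwa [Finset.sum_product] at h

/-- A hop between configurations on the two sides of `α` moves the `i`-th particle across. -/
theorem apply_eq_of_hop_across {α σ : ℤ} (hσ : σ = 1 ∨ σ = -1) {i : Fin n}
    (hi : ∀ f : Fin n → ℤ, StrictMono f → σ * α < σ * f i → ∀ j, σ * α < σ * f j)
    {w q : Config Λ n} (hw : ¬ ∀ j, σ * α < σ * w.1 j) (hq : ∀ j, σ * α < σ * q.1 j)
    (h : l1Dist w q = 1) : w.1 i = α ∧ q.1 i = α + σ ∧ ∀ j, j ≠ i → w.1 j = q.1 j := by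
  -- By `hi`, particle `i` is the last to get across `α`: the first particle for `σ = 1`, the last
  -- for `σ = -1`. Hence it is the one that hops.
  have hwi : ¬ σ * α < σ * w.1 i := fun h => hw (hi _ w.2.1 h)
  obtain ⟨a, τ, hτ, -, hqw⟩ := exists_hop_of_l1Dist_eq_one h
  have hqi := hqw i
  have hqi' := hq i
  have hwa : w.1 i = a := by
    by_contra hne
    rw [if_neg hne] at hqi
    rw [hqi] at hqi'
    exact hwi hqi'
  rw [if_pos hwa] at hqi
  refine ⟨?_, ?_, fun j hj => ?_⟩
  · rcases hσ with rfl | rfl <;> omega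
  · rcases hσ with rfl | rfl <;> omega
  · have hja : w.1 j ≠ a := fun h => hj (w.2.1.injective (h.trans hwa.symm))
    rw [hqw j, if_neg hja]

theorem sum_hop_across_le {α σ : ℤ} (hσ : σ = 1 ∨ σ = -1) {i : Fin n}
    (hi : ∀ f : Fin n → ℤ, StrictMono f → σ * α < σ * f i → ∀ j, σ * α < σ * f j)
    {q : Config Λ n} (hq : ∀ j, σ * α < σ * q.1 j) :
    ∑ w : {w : Config Λ n // ¬ ∀ j, σ * α < σ * w.1 j},
      (if l1Dist w.1 q = 1 then (1 : ℝ≥0∞) else 0) ≤ if q.1 i = α + σ then 1 else 0 := by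
  rw [Finset.sum_boole]
  split_ifs with hqi
  · have hcard : (Finset.univ.filter fun w : {w : Config Λ n // ¬ ∀ j, σ * α < σ * w.1 j} =>
        l1Dist w.1 q = 1).card ≤ 1 := by
      refine Finset.card_le_one.2 fun w hw w' hw' => ?_
      obtain ⟨h1, -, h2⟩ := apply_eq_of_hop_across hσ hi w.2 hq (Finset.mem_filter.1 hw).2
      obtain ⟨h3, -, h4⟩ := apply_eq_of_hop_across hσ hi w'.2 hq (Finset.mem_filter.1 hw').2
      refine Subtype.ext (Subtype.ext (funext fun j => ?_))
      by_cases hj : j = i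
      · rw [hj, h1, h3]
      · rw [h2 j hj, h4 j hj]
    exact_mod_cast hcard
  · rw [Finset.filter_eq_empty_iff.2 fun w _ hw =>
      hqi (apply_eq_of_hop_across hσ hi w.2 hq hw).2.1]
    simp

end Combinatorics

variable {Ω : Type*} [MeasurableSpace Ω] {P : Measure Ω} {Λ : Finset ℤ} {ρ : ℝ → ℝ}
  {ω : ℤ → Ω → ℝ} {n : ℕ}

theorem measurable_det_shifted {Θ : Type*} [MeasurableSpace Θ] (g lam E : ℝ) {v : Θ → ℤ → ℝ}
    (hv : ∀ β ∈ Λ, Measurable fun a => v a β) :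
    Measurable fun a => (shifted Λ n g lam (v a) E).det := by
  have := measurable_shifted (n := n) g lam E hv
  simp only [Matrix.det_apply']
  fun_prop

/-- Induction on the sites: once the system without `α` is invertible, a Schur complement leaves
finitely many bad values of the potential at `α`, a null set for an absolutely continuous law. -/
theorem IsDisorder.ae_isUnit_det_shifted [NeZero n] [IsProbabilityMeasure P]
    (h : IsDisorder P Λ ρ ω) (g E : ℝ) {lam : ℝ} (hlam : 0 < lam) (Λ' : Finset ℤ)
    (hΛ' : Λ' ⊆ Λ) :
    ∀ᵐ a ∂P, IsUnit (shifted Λ' n g lam (fun β => ω β a) E).det := by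
  induction Λ' using Finset.strongInduction with
  | H Λ' ih =>
  rcases Λ'.eq_empty_or_nonempty with rfl | ⟨α, hα⟩
  · have : IsEmpty (Config ∅ n) := ⟨fun x => by simpa using x.2.2 0⟩
    simp [Matrix.det_isEmpty]
  set Λ'' := Λ'.filter (fun a => a ≠ α) with hΛ''
  have hsub : Λ'' ⊂ Λ' := Finset.filter_ssubset.2 ⟨α, hα, by simp⟩
  have ih' := ih Λ'' hsub (hsub.1.trans hΛ')
  let B : Set (ℤ → ℝ) := {v | (shifted Λ' n g lam v E).det = 0 ∧
    (shifted Λ'' n g lam v E).det ≠ 0}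
  have hB : MeasurableSet B :=
    (measurable_det_shifted g lam E (v := id) (fun β _ => measurable_pi_apply β) (measurableSet_singleton 0)).inter
      (measurable_det_shifted g lam E (v := id) (fun β _ => measurable_pi_apply β) (measurableSet_singleton 0).compl)
  have hsite : ∀ u, ∫⁻ t, B.indicator 1 (Function.update u α t) ∂(siteLaw ρ) ≤ 0 := by
    intro u
    have hcongr : ∀ t, shifted Λ'' n g lam (Function.update u α t) E =
        shifted Λ'' n g lam (Function.update u α 0) E := fun t =>
      shifted_congr g lam E fun β hβ => by
        simp [(Finset.mem_filter.1 hβ).2]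
    by_cases hu : IsUnit (shifted Λ'' n g lam (Function.update u α 0) E).det
    · have hfin := Matrix.finite_setOf_not_isUnit_det_pencil
        (shifted Λ' n g lam (Function.update u α 0) E)
        (fun x => if α ∈ sites x then lam else 0) (fun w : Config Λ' n => ∀ j, w.1 j ≠ α)
        hlam.ne' (fun w hw => if_neg fun hα => by
          obtain ⟨j, -, hj⟩ := Finset.mem_image.1 hα
          exact hw j hj)
        (fun w hw => if_pos (by
          push Not at hw
          obtain ⟨j, hj⟩ := hw
          exact hj ▸ mem_sites w j))
        (by rw [shifted_submatrix (r := fun a => a ≠ α), Matrix.det_submatrix_equiv_self]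
            exact hu)
      have hnull : siteLaw ρ {t | ¬ IsUnit (shifted Λ' n g lam (Function.update u α 0) E +
          t • Matrix.diagonal fun x : Config Λ' n => if α ∈ sites x then lam else 0).det} = 0 :=
        withDensity_absolutelyContinuous _ _ (hfin.measure_zero _)
      rw [nonpos_iff_eq_zero]
      refine lintegral_eq_zero_of_ae_eq_zero ?_
      refine (measure_eq_zero_iff_ae_notMem.1 hnull).mono fun t ht => ?_
      refine Set.indicator_of_notMem (fun hmem => ht ?_) _
      rw [Set.mem_ofPred_eq, ← shifted_update, hmem.1]
      exact not_isUnit_zero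
    · rw [isUnit_iff_ne_zero, not_not] at hu
      refine le_of_eq (lintegral_eq_zero_of_ae_eq_zero (ae_of_all _ fun t => ?_))
      refine Set.indicator_of_notMem (fun hmem => hmem.2 ?_) _
      rw [hcongr, hu]
  -- The averaging lemma with `C = 0` and trivial second factor: the bad event has zero conditional
  -- probability, hence zero probability.
  have hzero := h.lintegral_mul_le (hΛ' hα) (F₁ := B.indicator 1) (F₂ := fun _ => 1)
    (measurable_one.indicator hB) measurable_const
    (fun u v huv => by
      have e1 := shifted_congr (n := n) g lam E fun β (hβ : β ∈ Λ') => huv β (hΛ' hβ)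
      have e2 := shifted_congr (n := n) g lam E
        fun β (hβ : β ∈ Λ'') => huv β (hΛ' (hsub.1 hβ))
      have : u ∈ B ↔ v ∈ B := by simp only [B, Set.mem_ofPred_eq, e1, e2]
      simp only [Set.indicator, this, Pi.one_apply])
    (fun _ _ _ => rfl) hsite
  rw [zero_mul, nonpos_iff_eq_zero] at hzero
  have hmω : ∀ β ∈ Λ', Measurable fun a => ω β a := fun β hβ => h.measurable β (hΛ' hβ)
  have hBω : MeasurableSet {a | (fun β => ω β a) ∈ B} :=
    (measurable_det_shifted g lam E (v := fun a β => ω β a) hmω (measurableSet_singleton 0)).inter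
      (measurable_det_shifted g lam E (v := fun a β => ω β a) (fun β hβ => hmω β (hsub.1 hβ))
        (measurableSet_singleton 0).compl)
  have hP : P {a | (fun β => ω β a) ∈ B} = 0 := by
    rw [← lintegral_indicator_one hBω, ← hzero]
    refine lintegral_congr fun a => ?_
    simp [Set.indicator]
  filter_upwards [ih', measure_eq_zero_iff_ae_notMem.1 hP] with a h1 h2
  rw [isUnit_iff_ne_zero] at h1 ⊢
  exact fun h0 => h2 ⟨h0, h1⟩

theorem notMem_spectrum_of_isUnit_det_shifted {g lam E : ℝ} {v : ℤ → ℝ}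
    (h : IsUnit (shifted Λ n g lam v E).det) : E ∉ spectrum ℝ (hamiltonian Λ n g lam v) := by
  rw [spectrum.mem_iff, not_not, ← neg_sub, IsUnit.neg_iff, Algebra.algebraMap_eq_smul_one,
    Matrix.isUnit_iff_isUnit_det]
  exact h

theorem fracMoment_comm (g lam s E : ℝ) (x y : Config Λ n) :
    fracMoment P ω Λ n g lam s E x y = fracMoment P ω Λ n g lam s E y x := by
  simp only [fracMoment, green_comm _ _ _ _ x y]

theorem measurable_ofReal_green {Θ : Type*} [MeasurableSpace Θ] (g lam s E : ℝ)
    {v : Θ → ℤ → ℝ} (hv : ∀ β ∈ Λ, Measurable fun a => v a β) (x y : Config Λ n) :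
    Measurable fun a => ENNReal.ofReal (|green Λ n g lam (v a) E x y| ^ s) :=
  ((measurable_green g lam E hv x y).abs.pow_const s).ennreal_ofReal

/-- Expansion of fractional moments onto clustered configurations. -/
theorem IsDisorder.fracMoment_le_sum [NeZero n] (h : IsDisorder P Λ ρ ω) (hρ : IsSiteDensity ρ)
    {g lam s μT E : ℝ} (hlam : 0 < lam) (hs0 : 0 < s) (hs1 : s < 1) (hμT : 0 ≤ μT)
    (hg : 0 < energyThreshold g μT) (hE : E < energyThreshold g μT) {Λ' : Finset ℤ}
    (hΛ' : Λ' ⊆ Λ) {x : Config Λ' n} (hx : IsClustered x) (y : Config Λ' n) :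
    fracMoment P ω Λ' n g lam s E x y ≤ ∑ z : Config Λ' n with IsClustered z,
      ENNReal.ofReal (Real.exp (-(s * μT * l1Dist z y))) *
        fracMoment P ω Λ' n g lam s E x z := by
  have hm : ∀ z, Measurable fun a =>
      ENNReal.ofReal (|green Λ' n g lam (fun β => ω β a) E x z| ^ s) := fun z =>
    measurable_ofReal_green g lam s E (fun β hβ => h.measurable β (hΛ' hβ)) x z
  calc fracMoment P ω Λ' n g lam s E x y
      ≤ ∫⁻ a, ∑ z : Config Λ' n with IsClustered z,
          ENNReal.ofReal (Real.exp (-(s * μT * l1Dist z y))) *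
            ENNReal.ofReal (|green Λ' n g lam (fun β => ω β a) E x z| ^ s) ∂P := by
        refine lintegral_mono_ae ((h.ae_nonneg hρ).mono fun a ha => ?_)
        have h1 := abs_green_le_sum hlam.le hμT (fun β hβ => ha β (hΛ' hβ)) hg hE hx y
        have h2 : ∑ z : Config Λ' n with IsClustered z, Real.exp (-(μT * l1Dist z y)) *
              |green Λ' n g lam (fun β => ω β a) E x z| =
            |∑ z : Config Λ' n with IsClustered z, (Real.exp (-(μT * l1Dist z y)) *
              |green Λ' n g lam (fun β => ω β a) E x z|)| :=
          (abs_of_nonneg (Finset.sum_nonneg fun z _ => by positivity)).symm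
        rw [h2] at h1
        refine (ENNReal.ofReal_le_ofReal (Real.rpow_le_rpow (abs_nonneg _) h1 hs0.le)).trans ?_
        refine (ofReal_abs_sum_rpow_le _ _ hs0 hs1.le).trans (le_of_eq ?_)
        refine Finset.sum_congr rfl fun z _ => ?_
        rw [ofReal_abs_mul_rpow, abs_abs, Real.abs_exp, ← Real.exp_mul]
        congr 4
        ring
    _ = _ := by
        rw [lintegral_finsetSum _ fun z _ => (hm z).const_mul _]
        exact Finset.sum_congr rfl fun z _ => lintegral_const_mul _ (hm z)

end Expansions

/-! ### Decoupling at a site and induction on the volume. -/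

section Localization

variable {Ω : Type*} [MeasurableSpace Ω] {P : Measure Ω} {Λ : Finset ℤ} {ρ : ℝ → ℝ}
  {ω : ℤ → Ω → ℝ} {n : ℕ}

theorem _root_.Finset.sum_union_le_sum_add_sum {ι : Type*} [DecidableEq ι] (S T : Finset ι)
    (f : ι → ℝ≥0∞) : ∑ i ∈ S ∪ T, f i ≤ ∑ i ∈ S, f i + ∑ i ∈ T, f i := by
  rw [← Finset.sum_union_inter]
  exact le_self_add

/-- The a-priori bound `C λ⁻ˢ` on fractional moments for a site density bounded by `b`. -/
def aprioriBound (b s lam : ℝ) : ℝ := (1 + 8 * b * s / (1 - s)) * lam ^ (-s)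

/-- Integrating out the potential at `α` in a product with a factor not depending on it. -/
theorem IsDisorder.lintegral_green_mul_le [IsProbabilityMeasure P] (h : IsDisorder P Λ ρ ω)
    {b : ℝ} (hb : 0 ≤ b) (hν : siteLaw ρ ≤ ENNReal.ofReal b • (volume : Measure ℝ))
    {g lam s E : ℝ} (hlam : 0 < lam) (hs0 : 0 < s) (hs1 : s < 1) {Λ' : Finset ℤ} (hΛ' : Λ' ⊆ Λ)
    {α : ℤ} {x w : Config Λ' n} (hx : α ∈ sites x) (hw : α ∈ sites w) {F : (ℤ → ℝ) → ℝ≥0∞}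
    (hF : Measurable F) (hloc : ∀ u v, (∀ β ∈ Λ, β ≠ α → u β = v β) → F u = F v) :
    ∫⁻ a, ENNReal.ofReal (|green Λ' n g lam (fun β => ω β a) E x w| ^ s) * F (fun β => ω β a) ∂P ≤
      ENNReal.ofReal (aprioriBound b s lam) * ∫⁻ a, F (fun β => ω β a) ∂P := by
  have hα : α ∈ Λ := by
    obtain ⟨j, -, rfl⟩ := Finset.mem_image.1 hx
    exact hΛ' (x.2.2 j)
  have := h.isProbabilityMeasure_siteLaw hα
  exact h.lintegral_mul_le hα
    (F₁ := fun v => ENNReal.ofReal (|green Λ' n g lam v E x w| ^ s))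
    (measurable_ofReal_green g lam s E (v := id) (fun β _ => measurable_pi_apply β) x w) hF
    (fun u v huv => by rw [green_congr g lam E fun β hβ => huv β (hΛ' hβ)]) hloc
    fun u => lintegral_green_update_le hb hν hlam hs0 hs1 u hx hw

theorem IsDisorder.fracMoment_self_le [NeZero n] [IsProbabilityMeasure P]
    (h : IsDisorder P Λ ρ ω)
    {b : ℝ} (hb : 0 ≤ b) (hν : siteLaw ρ ≤ ENNReal.ofReal b • (volume : Measure ℝ))
    {g lam s E : ℝ} (hlam : 0 < lam) (hs0 : 0 < s) (hs1 : s < 1) {Λ' : Finset ℤ} (hΛ' : Λ' ⊆ Λ)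
    (x : Config Λ' n) :
    fracMoment P ω Λ' n g lam s E x x ≤ ENNReal.ofReal (aprioriBound b s lam) := by
  have := h.lintegral_green_mul_le hb hν (g := g) (E := E) hlam hs0 hs1 hΛ' (mem_sites x 0)
    (mem_sites x 0) (F := fun _ => 1) measurable_const (fun _ _ _ => rfl)
  simpa [fracMoment] using this

/-- Removing the sites up to `α` (in direction `σ`) from the system. -/
theorem IsDisorder.fracMoment_le_sum_filter [NeZero n] [IsProbabilityMeasure P]
    (h : IsDisorder P Λ ρ ω)
    {b : ℝ} (hb : 0 ≤ b) (hν : siteLaw ρ ≤ ENNReal.ofReal b • (volume : Measure ℝ))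
    {g lam s E : ℝ} (hlam : 0 < lam) (hs0 : 0 < s) (hs1 : s < 1) {Λ' : Finset ℤ} (hΛ' : Λ' ⊆ Λ)
    {α σ : ℤ} (hσ : σ = 1 ∨ σ = -1) {i : Fin n}
    (hi : ∀ f : Fin n → ℤ, StrictMono f → σ * α < σ * f i → ∀ j, σ * α < σ * f j)
    {x : Config Λ' n} (hx : x.1 i = α) (y : {w : Config Λ' n // ∀ j, σ * α < σ * w.1 j}) :
    fracMoment P ω Λ' n g lam s E x y ≤ ENNReal.ofReal (aprioriBound b s lam) *
      ∑ q : Config (Λ'.filter fun a => σ * α < σ * a) n with q.1 i = α + σ,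
        fracMoment P ω (Λ'.filter fun a => σ * α < σ * a) n g lam s E q
          (configFilterEquiv Λ' n (fun a => σ * α < σ * a) y) := by
  set r : ℤ → Prop := fun a => σ * α < σ * a with hr
  set e := configFilterEquiv Λ' n r with he
  set κ := ENNReal.ofReal (aprioriBound b s lam)
  have hsub : Λ'.filter r ⊆ Λ := (Finset.filter_subset _ _).trans hΛ'
  have hxr : ¬ ∀ j, r (x.1 j) := fun hall => by
    have := hall i
    simp only [hr, hx, lt_self_iff_false] at this
  have hm1 : ∀ w, Measurable fun a =>
      ENNReal.ofReal (|green Λ' n g lam (fun β => ω β a) E x w| ^ s) := fun w =>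
    measurable_ofReal_green g lam s E (fun β hβ => h.measurable β (hΛ' hβ)) x w
  have hm2 : ∀ q, Measurable fun a =>
      ENNReal.ofReal (|green (Λ'.filter r) n g lam (fun β => ω β a) E q (e y)| ^ s) := fun q =>
    measurable_ofReal_green g lam s E (fun β hβ => h.measurable β (hsub hβ)) q (e y)
  have hterm : ∀ (w : {w : Config Λ' n // ¬ ∀ j, r (w.1 j)})
      (q : {w : Config Λ' n // ∀ j, r (w.1 j)}),
      (if l1Dist w.1 q.1 = 1 then (1 : ℝ≥0∞) else 0) *
        ∫⁻ a, ENNReal.ofReal (|green Λ' n g lam (fun β => ω β a) E x w| ^ s) *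
          ENNReal.ofReal (|green (Λ'.filter r) n g lam (fun β => ω β a) E (e q) (e y)| ^ s) ∂P ≤
      (if l1Dist w.1 q.1 = 1 then (1 : ℝ≥0∞) else 0) *
        (κ * fracMoment P ω (Λ'.filter r) n g lam s E (e q) (e y)) := by
    intro w q
    split_ifs with hd
    · rw [one_mul, one_mul]
      have hw : w.1.1 i = α := (apply_eq_of_hop_across hσ hi w.2 q.2 hd).1
      refine h.lintegral_green_mul_le hb hν hlam hs0 hs1 hΛ' (α := α) (hx ▸ mem_sites x i)
        (hw ▸ mem_sites w.1 i)
        (F := fun v => ENNReal.ofReal (|green (Λ'.filter r) n g lam v E (e q) (e y)| ^ s))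
        (measurable_ofReal_green g lam s E (v := id) (fun β _ => measurable_pi_apply β) _ _)
        (fun u v huv => ?_)
      rw [green_congr g lam E fun β hβ => huv β (hsub hβ) ?_]
      -- The site `α` has been deleted, so the second Green function does not see its potential.
      rintro rfl
      exact absurd (Finset.mem_filter.1 hβ).2 (lt_irrefl _)
    · simp
  calc fracMoment P ω Λ' n g lam s E x y
      ≤ ∫⁻ a, ∑ w : {w : Config Λ' n // ¬ ∀ j, r (w.1 j)},
          ∑ q : {w : Config Λ' n // ∀ j, r (w.1 j)},
          (if l1Dist w.1 q.1 = 1 then (1 : ℝ≥0∞) else 0) *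
          (ENNReal.ofReal (|green Λ' n g lam (fun β => ω β a) E x w| ^ s) *
          ENNReal.ofReal
            (|green (Λ'.filter r) n g lam (fun β => ω β a) E (e q) (e y)| ^ s)) ∂P := by
        refine lintegral_mono_ae
          ((h.ae_isUnit_det_shifted (n := n) g E hlam (Λ'.filter r) hsub).mono fun a ha => ?_)
        rw [green_eq_sum_of_filter g lam _ E r ha hxr y]
        refine (ofReal_abs_sum_rpow_le _ _ hs0 hs1.le).trans (Finset.sum_le_sum fun w _ => ?_)
        refine (ofReal_abs_sum_rpow_le _ _ hs0 hs1.le).trans (Finset.sum_le_sum fun q _ => ?_)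
        rw [ofReal_abs_mul_rpow, ofReal_abs_mul_rpow]
        split_ifs
        · simp [he]
        · simp [Real.zero_rpow hs0.ne']
    _ = ∑ w : {w : Config Λ' n // ¬ ∀ j, r (w.1 j)},
          ∑ q : {w : Config Λ' n // ∀ j, r (w.1 j)},
          (if l1Dist w.1 q.1 = 1 then (1 : ℝ≥0∞) else 0) *
          ∫⁻ a, ENNReal.ofReal (|green Λ' n g lam (fun β => ω β a) E x w| ^ s) *
          ENNReal.ofReal
            (|green (Λ'.filter r) n g lam (fun β => ω β a) E (e q) (e y)| ^ s) ∂P := by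
        have hm : ∀ (w : {w : Config Λ' n // ¬ ∀ j, r (w.1 j)})
            (q : {w : Config Λ' n // ∀ j, r (w.1 j)}), Measurable fun a =>
            ENNReal.ofReal (|green Λ' n g lam (fun β => ω β a) E x w| ^ s) * ENNReal.ofReal
              (|green (Λ'.filter r) n g lam (fun β => ω β a) E (e q) (e y)| ^ s) :=
          fun w q => (hm1 w).mul (hm2 (e q))
        rw [lintegral_finsetSum _ fun w _ =>
          Finset.measurable_fun_sum _ fun q _ => (hm w q).const_mul _]
        refine Finset.sum_congr rfl fun w _ => ?_
        rw [lintegral_finsetSum _ fun q _ => (hm w q).const_mul _]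
        exact Finset.sum_congr rfl fun q _ => lintegral_const_mul _ (hm w q)
    _ ≤ ∑ q : {w : Config Λ' n // ∀ j, r (w.1 j)},
          (∑ w : {w : Config Λ' n // ¬ ∀ j, r (w.1 j)},
            if l1Dist w.1 q.1 = 1 then (1 : ℝ≥0∞) else 0) *
          (κ * fracMoment P ω (Λ'.filter r) n g lam s E (e q) (e y)) := by
        simp only [Finset.sum_mul]
        rw [Finset.sum_comm]
        exact Finset.sum_le_sum fun q _ => Finset.sum_le_sum fun w _ => hterm w q
    _ ≤ ∑ q : {w : Config Λ' n // ∀ j, r (w.1 j)}, (if (e q).1 i = α + σ then 1 else 0) *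
          (κ * fracMoment P ω (Λ'.filter r) n g lam s E (e q) (e y)) :=
        Finset.sum_le_sum fun q _ => mul_le_mul_left (sum_hop_across_le hσ hi q.2) _
    _ = ∑ q : Config (Λ'.filter r) n, (if q.1 i = α + σ then 1 else 0) *
          (κ * fracMoment P ω (Λ'.filter r) n g lam s E q (e y)) :=
        e.sum_comp fun q : Config (Λ'.filter r) n => (if q.1 i = α + σ then 1 else 0) *
          (κ * fracMoment P ω (Λ'.filter r) n g lam s E q (e y))
    _ = _ := by
        simp only [ite_mul, one_mul, zero_mul]
        rw [← Finset.sum_filter, Finset.mul_sum]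

/-- Weighted sum over the clusters on one side of a cluster. -/
theorem IsDisorder.sum_fracMoment_le_one_side [NeZero n] [IsProbabilityMeasure P]
    (h : IsDisorder P Λ ρ ω) (hρ : IsSiteDensity ρ)
    {b : ℝ} (hb : 0 ≤ b) (hν : siteLaw ρ ≤ ENNReal.ofReal b • (volume : Measure ℝ))
    {g lam s μ μT E : ℝ} (hlam : 0 < lam) (hs0 : 0 < s) (hs1 : s < 1) (hμ : 0 < μ) (hμT : μ < μT)
    (hg : 0 < energyThreshold g μT) (hE : E < energyThreshold g μT)
    {Λ' : Finset ℤ} (hΛ' : Λ' ⊆ Λ)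
    {α σ : ℤ} (hσ : σ = 1 ∨ σ = -1) {i : Fin n}
    (hi : ∀ f : Fin n → ℤ, StrictMono f → σ * α < σ * f i → ∀ j, σ * α < σ * f j)
    {x : Config Λ' n} (hx : IsClustered x) (hxα : x.1 i = α) {T : ℝ≥0∞}
    (hT : ∀ z : Config (Λ'.filter fun a => σ * α < σ * a) n, IsClustered z →
      ∑ y : Config (Λ'.filter fun a => σ * α < σ * a) n with IsClustered y,
        ENNReal.ofReal (Real.exp (s * μ * firstDist z y)) *
          fracMoment P ω (Λ'.filter fun a => σ * α < σ * a) n g lam s E z y ≤ T) :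
    ∑ y : Config Λ' n with IsClustered y ∧ ∀ j, σ * α < σ * y.1 j,
      ENNReal.ofReal (Real.exp (s * μ * firstDist x y)) * fracMoment P ω Λ' n g lam s E x y ≤
    ENNReal.ofReal (aprioriBound b s lam) *
      (ENNReal.ofReal (Real.exp (s * μ) * partitionBound (s * (μT - μ))) * T) := by
  set r : ℤ → Prop := fun a => σ * α < σ * a with hr
  set κ := ENNReal.ofReal (aprioriBound b s lam)
  set Λ'' := Λ'.filter r with hΛ''
  let e : {w : Config Λ' n // ∀ j, r (w.1 j)} ≃ Config Λ'' n := configFilterEquiv Λ' n r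
  have hsub : Λ'' ⊆ Λ := (Finset.filter_subset _ _).trans hΛ'
  have hsum : ∑ y : Config Λ' n with IsClustered y ∧ ∀ j, r (y.1 j),
      ENNReal.ofReal (Real.exp (s * μ * firstDist x y)) * fracMoment P ω Λ' n g lam s E x y =
      ∑ y : Config Λ'' n with IsClustered y,
      ENNReal.ofReal (Real.exp (s * μ * (x.1 0 - y.1 0).natAbs)) *
        fracMoment P ω Λ' n g lam s E x (e.symm y).1 := by
    refine (Finset.sum_nbij (fun y => (e.symm y).1) (fun y hy => ?_) (fun y _ z _ hyz => ?_)
      (fun y hy => ?_) (fun y hy => rfl)).symm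
    · exact Finset.mem_filter.2 ⟨Finset.mem_univ _, (Finset.mem_filter.1 hy).2, (e.symm y).2⟩
    · exact e.symm.injective (Subtype.ext hyz)
    · obtain ⟨-, hy1, hy2⟩ := Finset.mem_filter.1 (Finset.mem_coe.1 hy)
      refine ⟨e ⟨y, hy2⟩, Finset.mem_coe.2 (Finset.mem_filter.2 ⟨Finset.mem_univ _, hy1⟩), ?_⟩
      simp
  have hpt : ∀ y : Config Λ'' n, IsClustered y →
      ENNReal.ofReal (Real.exp (s * μ * (x.1 0 - y.1 0).natAbs)) *
        fracMoment P ω Λ' n g lam s E x (e.symm y).1 ≤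
      κ * ∑ z : Config Λ'' n with IsClustered z, ∑ q : Config Λ'' n with q.1 i = α + σ,
        ENNReal.ofReal (Real.exp (s * μ)) *
          ENNReal.ofReal (Real.exp (-(s * (μT - μ) * l1Dist z q))) *
          (ENNReal.ofReal (Real.exp (s * μ * firstDist z y)) *
            fracMoment P ω Λ'' n g lam s E z y) := by
    intro y hy
    have h1 := h.fracMoment_le_sum_filter hb hν (g := g) (E := E) hlam hs0 hs1 hΛ' hσ hi hxα
      (e.symm y)
    have h2 : configFilterEquiv Λ' n r (e.symm y) = y := e.apply_symm_apply y
    rw [h2] at h1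
    refine (mul_le_mul_right h1 _).trans ?_
    rw [mul_left_comm]
    refine mul_le_mul_right ?_ _
    rw [Finset.sum_comm, Finset.mul_sum]
    refine Finset.sum_le_sum fun q hq => ?_
    have hqi : q.1 i = α + σ := (Finset.mem_filter.1 hq).2
    -- The expansion onto clusters starts from a clustered endpoint, so symmetry is used to expand
    -- from `y`.
    rw [fracMoment_comm]
    refine (mul_le_mul_right (h.fracMoment_le_sum hρ hlam hs0 hs1 (hμ.trans hμT).le hg hE hsub
      hy q) _).trans ?_
    rw [Finset.mul_sum]
    refine Finset.sum_le_sum fun z hz => ?_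
    have hz := (Finset.mem_filter.1 hz).2
    rw [fracMoment_comm (x := y), ← mul_assoc, ← mul_assoc]
    refine mul_le_mul_left ?_ _
    rw [← ENNReal.ofReal_mul (by positivity), ← ENNReal.ofReal_mul (by positivity),
      ← ENNReal.ofReal_mul (by positivity), ← Real.exp_add, ← Real.exp_add, ← Real.exp_add]
    refine ENNReal.ofReal_le_ofReal (Real.exp_le_exp.2 ?_)
    -- For clusters the displacement of the first particle equals that of the `i`-th. The latter is
    -- followed from `x` to `q`, one step across `α`, then from `q` to `z`.
    have hd : (x.1 0 - y.1 0).natAbs ≤ 1 + l1Dist z q + firstDist z y := by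
      have h2 := natAbs_sub_le_l1Dist z q i
      have h3 := hz.apply_eq i
      have h4 := hx.apply_eq i
      simp only [firstDist]
      rcases hσ with rfl | rfl <;> omega
    have hd' : ((x.1 0 - y.1 0).natAbs : ℝ) ≤ 1 + l1Dist z q + firstDist z y := by
      exact_mod_cast hd
    have hsμ : 0 < s * μ := mul_pos hs0 hμ
    nlinarith [mul_le_mul_of_nonneg_left hd' hsμ.le]
  rw [hsum]
  calc _ ≤ ∑ y : Config Λ'' n with IsClustered y, κ * ∑ z : Config Λ'' n with IsClustered z,
        ∑ q : Config Λ'' n with q.1 i = α + σ, ENNReal.ofReal (Real.exp (s * μ)) *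
          ENNReal.ofReal (Real.exp (-(s * (μT - μ) * l1Dist z q))) *
          (ENNReal.ofReal (Real.exp (s * μ * firstDist z y)) *
            fracMoment P ω Λ'' n g lam s E z y) :=
        Finset.sum_le_sum fun y hy => hpt y (Finset.mem_filter.1 hy).2
    _ = κ * ∑ z : Config Λ'' n with IsClustered z, ∑ q : Config Λ'' n with q.1 i = α + σ,
          ENNReal.ofReal (Real.exp (s * μ)) *
          ENNReal.ofReal (Real.exp (-(s * (μT - μ) * l1Dist z q))) *
          ∑ y : Config Λ'' n with IsClustered y, (ENNReal.ofReal (Real.exp (s * μ * firstDist z y)) *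
            fracMoment P ω Λ'' n g lam s E z y) := by
        rw [← Finset.mul_sum, Finset.sum_comm]
        congr 1
        refine Finset.sum_congr rfl fun z _ => ?_
        rw [Finset.sum_comm]
        simp only [Finset.mul_sum]
    _ ≤ κ * ∑ z : Config Λ'' n with IsClustered z, ∑ q : Config Λ'' n with q.1 i = α + σ,
          ENNReal.ofReal (Real.exp (s * μ)) *
          ENNReal.ofReal (Real.exp (-(s * (μT - μ) * l1Dist z q))) * T := by
        refine mul_le_mul_right (Finset.sum_le_sum fun z hz => Finset.sum_le_sum fun q _ => ?_) _
        exact mul_le_mul_right (hT z (Finset.mem_filter.1 hz).2) _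
    _ = κ * (ENNReal.ofReal (Real.exp (s * μ)) * (∑ z : Config Λ'' n with IsClustered z,
          ∑ q : Config Λ'' n with q.1 i = α + σ,
          ENNReal.ofReal (Real.exp (-(s * (μT - μ) * l1Dist z q)))) * T) := by
        simp only [Finset.mul_sum, Finset.sum_mul]
    _ ≤ _ := by
        rw [ENNReal.ofReal_mul (Real.exp_pos _).le]
        gcongr
        exact sum_exp_l1Dist_le_of_apply_eq (mul_pos hs0 (sub_pos.2 hμT)) i (α + σ)

/-- Localization of clusters at strong disorder, in fractional moments. -/
theorem IsDisorder.sum_fracMoment_le_two [NeZero n] [IsProbabilityMeasure P]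
    (h : IsDisorder P Λ ρ ω) (hρ : IsSiteDensity ρ)
    {b : ℝ} (hb : 0 ≤ b) (hν : siteLaw ρ ≤ ENNReal.ofReal b • (volume : Measure ℝ))
    {g lam s μ μT E : ℝ} (hlam : 0 < lam) (hs0 : 0 < s) (hs1 : s < 1) (hμ : 0 < μ) (hμT : μ < μT)
    (hg : 0 < energyThreshold g μT) (hE : E < energyThreshold g μT)
    (hsmall : aprioriBound b s lam *
      (4 * (Real.exp (s * μ) * partitionBound (s * (μT - μ))) + 1) ≤ 1)
    (Λ' : Finset ℤ) (hΛ' : Λ' ⊆ Λ) (x : Config Λ' n) (hx : IsClustered x) :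
    ∑ y : Config Λ' n with IsClustered y,
      ENNReal.ofReal (Real.exp (s * μ * firstDist x y)) * fracMoment P ω Λ' n g lam s E x y ≤
      2 := by
  induction Λ' using Finset.strongInduction with
  | H Λ' ih =>
  set B := Real.exp (s * μ) * partitionBound (s * (μT - μ)) with hB
  have hB0 : 0 ≤ B := mul_nonneg (Real.exp_pos _).le (Real.exp_pos _).le
  have ha0 : 0 ≤ aprioriBound b s lam :=
    mul_nonneg (add_nonneg zero_le_one (div_nonneg (by positivity) (by linarith)))
      (Real.rpow_nonneg hlam.le _)
  have hside : ∀ (σ : ℤ) (_ : σ = 1 ∨ σ = -1) (i : Fin n)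
      (_ : ∀ f : Fin n → ℤ, StrictMono f → σ * x.1 i < σ * f i → ∀ j, σ * x.1 i < σ * f j),
      ∑ y : Config Λ' n with IsClustered y ∧ ∀ j, σ * x.1 i < σ * y.1 j,
        ENNReal.ofReal (Real.exp (s * μ * firstDist x y)) * fracMoment P ω Λ' n g lam s E x y ≤
      ENNReal.ofReal (aprioriBound b s lam * (2 * B)) := by
    intro σ hσ i hi
    have hss : (Λ'.filter fun a => σ * x.1 i < σ * a) ⊂ Λ' :=
      Finset.filter_ssubset.2 ⟨x.1 i, x.2.2 i, lt_irrefl _⟩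
    refine (h.sum_fracMoment_le_one_side hρ hb hν hlam hs0 hs1 hμ hμT hg hE hΛ' hσ hi hx rfl
      (T := 2) fun z hz => ih _ hss (hss.1.trans hΛ') z hz).trans (le_of_eq ?_)
    rw [← hB, show (2 : ℝ≥0∞) = ENNReal.ofReal 2 by simp, ← ENNReal.ofReal_mul hB0,
      ← ENNReal.ofReal_mul ha0, mul_comm B]
  have hn : 0 < n := NeZero.pos n
  set l : Fin n := ⟨n - 1, by omega⟩ with hl
  have h0l : ∀ j : Fin n, j ≤ l := fun j => Fin.le_def.2 (by simp only [hl]; omega)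
  have hR := hside 1 (Or.inl rfl) 0 (fun f hf h0 j => by
    have := hf.monotone (Fin.zero_le j); omega)
  have hL := hside (-1) (Or.inr rfl) l (fun f hf h0 j => by
    have := hf.monotone (h0l j); omega)
  have hself := h.fracMoment_self_le hb hν (g := g) (E := E) hlam hs0 hs1 hΛ' x
  -- Sides are chosen relative to the two ends of `x`, so a cluster overlapping `x` without being
  -- equal to it still avoids one deleted half-line.
  have hcover : (Finset.univ.filter fun y : Config Λ' n => IsClustered y) ⊆
      {x} ∪ ((Finset.univ.filter fun y : Config Λ' n =>
          IsClustered y ∧ ∀ j, 1 * x.1 0 < 1 * y.1 j) ∪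
        (Finset.univ.filter fun y : Config Λ' n =>
          IsClustered y ∧ ∀ j, -1 * x.1 l < -1 * y.1 j)) := by
    intro y hy
    have hy := (Finset.mem_filter.1 hy).2
    rw [Finset.mem_union, Finset.mem_union, Finset.mem_singleton, Finset.mem_filter,
      Finset.mem_filter]
    rcases lt_trichotomy (x.1 0) (y.1 0) with hlt | heq | hgt
    · refine Or.inr (Or.inl ⟨Finset.mem_univ _, hy, fun j => ?_⟩)
      have := y.2.1.monotone (Fin.zero_le j); omega
    · refine Or.inl (Subtype.ext (funext fun j => ?_))
      rw [hy.apply_eq j, hx.apply_eq j, heq]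
    · refine Or.inr (Or.inr ⟨Finset.mem_univ _, hy, fun j => ?_⟩)
      have h1 := y.2.1.monotone (h0l j)
      have h2 := hy.apply_eq l
      have h3 := hx.apply_eq l
      omega
  calc _ ≤ ENNReal.ofReal (aprioriBound b s lam) +
        (ENNReal.ofReal (aprioriBound b s lam * (2 * B)) +
          ENNReal.ofReal (aprioriBound b s lam * (2 * B))) := by
        refine (Finset.sum_le_sum_of_subset hcover).trans ?_
        refine (Finset.sum_union_le_sum_add_sum _ _ _).trans (add_le_add ?_
          ((Finset.sum_union_le_sum_add_sum _ _ _).trans (add_le_add hR hL)))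
        rw [Finset.sum_singleton]
        simpa [firstDist] using hself
    -- The `1` is the diagonal term; the `4` is two sides times the inductive bound `2`.
    _ = ENNReal.ofReal (aprioriBound b s lam * (4 * B + 1)) := by
        rw [← ENNReal.ofReal_add (by positivity) (by positivity),
          ← ENNReal.ofReal_add (by positivity) (by positivity)]
        congr 1; ring
    _ ≤ ENNReal.ofReal 1 := ENNReal.ofReal_le_ofReal hsmall
    _ ≤ 2 := by simp

/-- Passing from clustered to arbitrary endpoints. -/
theorem IsDisorder.sum_dbar_fracMoment_le [NeZero n] (h : IsDisorder P Λ ρ ω)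
    (hρ : IsSiteDensity ρ) {g lam s μ μT E : ℝ} (hlam : 0 < lam) (hs0 : 0 < s) (hs1 : s < 1)
    (hμ : 0 < μ) (hμT : μ < μT)
    (hg : 0 < energyThreshold g μT) (hE : E < energyThreshold g μT)
    {Λ' : Finset ℤ} (hΛ' : Λ' ⊆ Λ) {x : Config Λ' n} (hx : IsClustered x) {T : ℝ≥0∞}
    (hT : ∑ z : Config Λ' n with IsClustered z,
      ENNReal.ofReal (Real.exp (s * μ * firstDist x z)) *
        fracMoment P ω Λ' n g lam s E x z ≤ T) :
    ∑ y : Config Λ' n,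
      ENNReal.ofReal (Real.exp (s * μ * dbar x y)) * fracMoment P ω Λ' n g lam s E x y ≤
      T * ENNReal.ofReal (partitionBound (s * (μT - μ))) := by
  have hsμ : 0 < s * μ := mul_pos hs0 hμ
  calc _ ≤ ∑ y : Config Λ' n, ∑ z : Config Λ' n with IsClustered z,
        ENNReal.ofReal (Real.exp (s * μ * firstDist x z)) *
          fracMoment P ω Λ' n g lam s E x z *
          ENNReal.ofReal (Real.exp (-(s * (μT - μ) * l1Dist z y))) := by
        refine Finset.sum_le_sum fun y _ => ?_
        refine (mul_le_mul_right (h.fracMoment_le_sum hρ hlam hs0 hs1 (hμ.trans hμT).le hg hE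
          hΛ' hx y) _).trans ?_
        rw [Finset.mul_sum]
        refine Finset.sum_le_sum fun z hz => ?_
        have hz := (Finset.mem_filter.1 hz).2
        rw [← mul_assoc, mul_right_comm (ENNReal.ofReal (Real.exp (s * μ * firstDist x z)))]
        refine mul_le_mul_left ?_ _
        rw [← ENNReal.ofReal_mul (by positivity), ← ENNReal.ofReal_mul (by positivity),
          ← Real.exp_add, ← Real.exp_add]
        refine ENNReal.ofReal_le_ofReal (Real.exp_le_exp.2 ?_)
        -- Admissible choice in the minimum: `w = x`, already clustered, and `v = z`.
        have hd : dbar x y ≤ firstDist x z + l1Dist z y :=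
          Nat.sInf_le ⟨x, z, hx, hz, by rw [l1Dist_self, zero_add]⟩
        have hd' : (dbar x y : ℝ) ≤ firstDist x z + l1Dist z y := by exact_mod_cast hd
        nlinarith [mul_le_mul_of_nonneg_left hd' hsμ.le]
    _ = ∑ z : Config Λ' n with IsClustered z,
        ENNReal.ofReal (Real.exp (s * μ * firstDist x z)) *
          fracMoment P ω Λ' n g lam s E x z *
          ∑ y : Config Λ' n, ENNReal.ofReal (Real.exp (-(s * (μT - μ) * l1Dist z y))) := by
        rw [Finset.sum_comm]
        simp only [Finset.mul_sum]
    _ ≤ ∑ z : Config Λ' n with IsClustered z,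
        ENNReal.ofReal (Real.exp (s * μ * firstDist x z)) *
          fracMoment P ω Λ' n g lam s E x z *
          ENNReal.ofReal (partitionBound (s * (μT - μ))) :=
        Finset.sum_le_sum fun z hz => mul_le_mul_right
          (sum_exp_l1Dist_le_of_isClustered (mul_pos hs0 (sub_pos.2 hμT))
            (Finset.mem_filter.1 hz).2) _
    _ ≤ _ := by
        rw [← Finset.sum_mul]
        exact mul_le_mul_left hT _

end Localization

end HardCore

end

/-! ### Choice of constants. -/

theorem theorem3p2
    (g μT : ℝ) (hg : 1 < g) (hμT : 0 < μT) (hgμ : 0 < energyThreshold g μT)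
    (I : Set ℝ) (hI : I.OrdConnected) (hIc : IsCompact I)
    (hIE : I ⊆ Set.Ico 0 (energyThreshold g μT))
    (s : ℝ) (hs : s ∈ Set.Ioo (0 : ℝ) 1) (μ : ℝ) (hμ : μ ∈ Set.Ioo 0 μT)
    (ρ : ℝ → ℝ) (hρ : IsSiteDensity ρ) :
    ∃ C₁ C₂ lam₀ : ℝ, 0 < C₁ ∧ 0 < C₂ ∧ 0 < lam₀ ∧
      ∀ (n : ℕ) [NeZero n], 2 ≤ n → ∀ (L : ℕ)
        (Ω : Type*) [MeasurableSpace Ω] (P : MeasureTheory.Measure Ω)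
        [MeasureTheory.IsProbabilityMeasure P] (ω : ℤ → Ω → ℝ), IsDisorder P (box L) ρ ω →
      ∀ lam : ℝ, lam₀ < lam → ∀ E ∈ I,
        (∀ Λ' ⊆ box L, ∀ᵐ a ∂P,
          E ∉ spectrum ℝ (hamiltonian Λ' n g lam fun α => ω α a)) ∧
        S₁ P ω (box L) n g lam s μ E ≤ ENNReal.ofReal C₁ ∧
        S₂ P ω (box L) n g lam s μ E ≤ ENNReal.ofReal C₂ := by
  obtain ⟨b, hb, hν⟩ := hρ.exists_siteLaw_le
  obtain ⟨hs0, hs1⟩ := hs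
  obtain ⟨hμ0, hμ1⟩ := hμ
  have h1s : 0 < 1 - s := by linarith
  set Z := partitionBound (s * (μT - μ)) with hZ
  have hZ0 : 0 < Z := Real.exp_pos _
  set B := 4 * (Real.exp (s * μ) * Z) + 1 with hB
  have hB0 : 0 < B := by positivity
  set K := 1 + 8 * b * s / (1 - s) with hK
  have hK0 : 0 < K := by positivity
  -- The threshold is where `K * B * lam ^ (-s)` falls to `1`, the smallness needed by the
  -- induction. `K`, `B` and `Z` involve neither `n` nor `L`.
  refine ⟨2, 2 * Z, (K * B) ^ s⁻¹, by norm_num, by positivity, by positivity, ?_⟩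
  intro n _ _ L Ω _ P _ ω hω lam hlam₀ E hE
  have hlam : 0 < lam := lt_trans (by positivity) hlam₀
  have hsmall : aprioriBound b s lam * B ≤ 1 := by
    have h1 : K * B ≤ lam ^ s := by
      have := Real.rpow_le_rpow (by positivity) hlam₀.le hs0.le
      rwa [← Real.rpow_mul (by positivity), inv_mul_cancel₀ hs0.ne', Real.rpow_one] at this
    have h2 : 0 < lam ^ s := Real.rpow_pos_of_pos hlam s
    rw [aprioriBound, ← hK, Real.rpow_neg hlam.le, mul_right_comm, ← div_eq_mul_inv,
      div_le_one h2]
    exact h1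
  have hE' := (hIE hE).2
  have hT : ∀ Λ' ⊆ box L, ∀ x : Config Λ' n, Config.IsClustered x →
      ∑ y : Config Λ' n with Config.IsClustered y,
        ENNReal.ofReal (Real.exp (s * μ * Config.firstDist x y)) *
          fracMoment P ω Λ' n g lam s E x y ≤ 2 := fun Λ' hΛ' x hx =>
    hω.sum_fracMoment_le_two hρ hb hν hlam hs0 hs1 hμ0 hμ1 hgμ hE' hsmall Λ' hΛ' x hx
  refine ⟨fun Λ' hΛ' => ?_, ?_, ?_⟩
  · exact (hω.ae_isUnit_det_shifted g E hlam Λ' hΛ').mono fun a ha =>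
      notMem_spectrum_of_isUnit_det_shifted ha
  · refine iSup₂_le fun Λ' hΛ' => iSup₂_le fun x hx => ?_
    exact (hT Λ' hΛ' x hx).trans (by simp)
  · refine iSup₂_le fun Λ' hΛ' => iSup₂_le fun x hx => ?_
    refine (hω.sum_dbar_fracMoment_le hρ hlam hs0 hs1 hμ0 hμ1 hgμ hE' hΛ' hx
      (hT Λ' hΛ' x hx)).trans (le_of_eq ?_)
    rw [ENNReal.ofReal_mul (by norm_num), hZ]
    simp
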